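/- **Mersenne Twister.** Let $n\ge 1$ (state size) and $w\ge 0$ (word length). The constants are $m,u,s,t,l\in\mathbb N$ and $\mathbf{upper},\mathbf a,\mathbf b,\mathbf c\in\{0,1\}^w$, with $\mathbf{lower}=\neg\,\mathbf{upper}$. Starting from a state $x[0],\dots,x[n-1]\in\{0,1\}^w$, step $i=0,1,2,\dots$ computes $$\mathbf t=(x[i \bmod n]\wedge \mathbf{upper})\vee(x[(i+1)\bmod n]\wedge\mathbf{lower}),\qquad \mathbf z=x[(i+m)\bmod n]\oplus(\mathbf t\gg 1)\oplus(\mathbf a\text{ if the lowest bit of }\mathbf t\text{ is }1,\text{ else }\mathbf 0),$$ sets $x[i\bmod n]\leftarrow \mathbf z$, and outputs the number $y_i$ obtained from $\mathbf y=\mathbf z$ by $\mathbf y\leftarrow \mathbf y\oplus(\mathbf y\gg u)$, $\mathbf y\leftarrow \mathbf y\oplus((\mathbf y\ll s)\wedge \mathbf b)$, $\mathbf y\leftarrow \mathbf y\oplus((\mathbf y\ll t)\wedge \mathbf c)$, $\mathbf y\leftarrow \mathbf y\oplus(\mathbf y\gg l)$. Let $x^{(i)}$ denote the state after $i$ steps.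 **Transformer.** Tokens are the $w$-bit numbers and a separator $\Rightarrow$. A decoder-only Transformer of hidden dimension $d$ maps the token $s_j$ at position $j=1,2,\dots$ to $\mathrm{Embed}(s_j)+\mathrm{pos}(j)\in\mathbb R^d$. It then applies layers $$\mathbf h_i=\mathbf x_i+\sum_{h=1}^{H}\Bigl(\sum_{j\le i}\mathrm{softmax}_{j\le i}\bigl(\langle \mathbf x_iW_Q^h,\mathbf x_jW_K^h\rangle/\sqrt{d_k}\bigr)\,\mathbf x_jW_V^h\Bigr)W_O^h,\qquad \mathbf x_i'=\mathbf h_i+\mathrm{GeLU}(\mathbf h_iW_1+\mathbf b_1)W_2,$$ with $W_Q^h,W_K^h,W_V^h\in\mathbb R^{d\times d_k}$, $W_O^h\in\mathbb R^{d_k\times d}$, $W_1,W_2\in\mathbb R^{d\times d}$, $\mathbf b_1\in\mathbb R^d$, $Hd_k=d$. The distribution of the next token is the softmax of a linear function (output matrix) of the last vector. Decoding is greedy: the unique most probable token is appended and the procedure is repeated. The parameters are the entries of the token embedding, of all layer weights and biases, and of the output matrix. "With rounding $\rho:\mathbb R\to\mathbb R$" means that $\rho$ is applied to every coordinate of $\mathbf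 h_i$, of the $\mathrm{GeLU}$ hidden units and of $\mathbf x_i'$, and to every output logit; $\rho=\mathrm{id}$ is exact arithmetic. **Theorem.** For every $\varepsilon>0$ there are constants $C,k\in\mathbb N$ such that for all $n\ge1$, $N\ge 0$, $w\ge 0$ and all Mersenne Twister constants as above there are a decoder-only Transformer, $p\in\mathbb N$ and $B\in\mathbb R$ with the following properties. 1. It has exactly seventeen layers, at most four attention heads in each layer, and hidden dimension $d\le C\,(n+N+w)$. (So for a fixed word length, $d=O(n)$ when $N=n$ numbers are generated.) 2. All parameters are polynomially bounded and of logarithmic precision: each is an integer multiple of $2^{-p}$ of absolute value at most $B$, where $B\le C(n+N+w)^k$ and $2^p\le C(n+N+w)^k$. 3. A token $s$ at position $j$ enters as $(\phi(s),j,1,0,\dots,0)\in\mathbb R^d$, where $d\ge w+2$, $\phi(s)\in\{0,1\}^w$ is the binary representation, and $\phi(\Rightarrow)=\mathbf 0$. 4. Let $\rho$ be any rounding with $|\rho(y)-y|\le 2^{-p}$ for all $|y|\le B$, and let $x^{(0)}\in(\{0,1\}^w)^n$ be any initial state. Started on the prompt $x^{(0)}[0]\,\dots\,x^{(0)}[n-1]\Rightarrow$,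 the Transformer with rounding $\rho$ autoregressively generates exactly the chain of thought consisting, for $i=0,1,\dots,N-1$ in this order, of the blocks $$y_i\;\;x^{(i+1)}[0]\;\cdots\;x^{(i+1)}[n-1]\;\Rightarrow .$$ So it generates the $N$ pseudo-random numbers $y_0,\dots,y_{N-1}$. Moreover, at each of these generation steps the first $w$ coordinates of the last layer's output at the last position differ from $\phi$ of the next token by at most $\varepsilon$. -/

import Mathlib

namespace MTTransformer

/-! ## Decoder-only Transformers -/

/-- The activation `GeLU(x) = x · Φ(x)`, with `Φ` the standard normal distribution function. -/
noncomputable def gelu (x : ℝ) : ℝ :=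
  x * ProbabilityTheory.cdf (ProbabilityTheory.gaussianReal 0 1) x

/-- Weights of one layer of hidden dimension `d` with `H` heads of dimension `dk = d / H`. -/
structure Layer (d : ℕ) where
  H : ℕ
  dk : ℕ
  heads : H * dk = d
  WQ : Fin H → Matrix (Fin d) (Fin dk) ℝ
  WK : Fin H → Matrix (Fin d) (Fin dk) ℝ
  WV : Fin H → Matrix (Fin d) (Fin dk) ℝ
  WO : Fin H → Matrix (Fin dk) (Fin d) ℝ
  W1 : Matrix (Fin d) (Fin d) ℝ
  b1 : Fin d → ℝ
  W2 : Matrix (Fin d) (Fin d) ℝ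

namespace Layer

variable {d L : ℕ} (lay : Layer d)

/-- Every weight and bias of the layer satisfies `P`. -/
def AllParams (P : ℝ → Prop) : Prop :=
  (∀ h i j, P (lay.WQ h i j)) ∧ (∀ h i j, P (lay.WK h i j)) ∧
  (∀ h i j, P (lay.WV h i j)) ∧ (∀ h i j, P (lay.WO h i j)) ∧
  (∀ i j, P (lay.W1 i j)) ∧ (∀ i, P (lay.b1 i)) ∧ (∀ i j, P (lay.W2 i j))

/-- Scaled dot product `⟨q_i, k_j⟩ / √d_k` in head `h`. -/
noncomputable def score (X : Fin L → Fin d → ℝ) (h : Fin lay.H) (i j : Fin L) : ℝ :=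
  (Matrix.vecMul (X i) (lay.WQ h) ⬝ᵥ Matrix.vecMul (X j) (lay.WK h)) / √(lay.dk : ℝ)

/-- Causal softmax weight of position `j` for the query position `i` (used for `j ≤ i` only). -/
noncomputable def attnWeight (X : Fin L → Fin d → ℝ) (h : Fin lay.H) (i j : Fin L) : ℝ :=
  Real.exp (lay.score X h i j) / ∑ j' ∈ Finset.Iic i, Real.exp (lay.score X h i j')

/-- Causal multi-head attention, without the residual connection. -/
noncomputable def attention (X : Fin L → Fin d → ℝ) (i : Fin L) : Fin d → ℝ :=
  ∑ h : Fin lay.H,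
    Matrix.vecMul
      (∑ j ∈ Finset.Iic i, lay.attnWeight X h i j • Matrix.vecMul (X j) (lay.WV h)) (lay.WO h)

/-- The feed-forward network `GeLU(x W₁ + b₁) W₂`, without the residual connection; the hidden
units are stored after rounding by `ρ`. -/
noncomputable def ffn (ρ : ℝ → ℝ) (x : Fin d → ℝ) : Fin d → ℝ :=
  Matrix.vecMul (fun c => ρ (gelu ((Matrix.vecMul x lay.W1 + lay.b1) c))) lay.W2

/-- Residual attention sublayer. -/
noncomputable def attnRes (ρ : ℝ → ℝ) (X : Fin L → Fin d → ℝ) (i : Fin L) : Fin d → ℝ :=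
  fun c => ρ ((lay.attention X i + X i) c)

/-- The whole layer: residual attention followed by the residual feed-forward network. Exact
real arithmetic is the case `ρ = id`. -/
noncomputable def apply (ρ : ℝ → ℝ) (X : Fin L → Fin d → ℝ) (i : Fin L) : Fin d → ℝ :=
  fun c => ρ ((lay.attnRes ρ X i + lay.ffn ρ (lay.attnRes ρ X i)) c)

end Layer

/-- A decoder-only Transformer over the vocabulary `V` with hidden dimension `d`. -/
structure Transformer (V : Type) (d : ℕ) where
  embed : V → Fin d → ℝ
  pos : ℕ → Fin d → ℝ
  layers : List (Layer d)
  unembed : V → Fin d → ℝ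

namespace Transformer

variable {V : Type} {d : ℕ} (T : Transformer V d)

/-- Every trainable parameter satisfies `P` (token embedding, all layers, output matrix). -/
def AllParams (P : ℝ → Prop) : Prop :=
  (∀ v c, P (T.embed v c)) ∧ (∀ v c, P (T.unembed v c)) ∧ ∀ lay ∈ T.layers, lay.AllParams P

/-- `Embed(s_i) + pos(i)`; positions are counted from `1`. -/
def input (s : List V) (i : Fin s.length) : Fin d → ℝ :=
  T.embed (s.get i) + T.pos (i + 1)

/-- The vectors at all positions of `s` after the last layer. -/
noncomputable def hidden (ρ : ℝ → ℝ) (s : List V) : Fin s.length → Fin d → ℝ :=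
  T.layers.foldl (fun X lay => lay.apply ρ X) (T.input s)

/-- The output vector at the last position of the (non-empty) sequence `s`. -/
noncomputable def final (ρ : ℝ → ℝ) (s : List V) : Fin d → ℝ :=
  if h : 0 < s.length then T.hidden ρ s ⟨s.length - 1, Nat.sub_lt h Nat.one_pos⟩ else 0

/-- The softmax distribution of the token that follows `s`. -/
noncomputable def nextProb [Fintype V] (ρ : ℝ → ℝ) (s : List V) (v : V) : ℝ :=
  Real.exp (ρ (T.final ρ s ⬝ᵥ T.unembed v)) / ∑ v', Real.exp (ρ (T.final ρ s ⬝ᵥ T.unembed v'))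

/-- `v` is the unique most probable token after `s`. -/
def IsNext [Fintype V] (ρ : ℝ → ℝ) (s : List V) (v : V) : Prop :=
  ∀ v', v' ≠ v → T.nextProb ρ s v' < T.nextProb ρ s v

/-- Autoregressive decoding: started on `prompt`, and with each produced token appended to the
sequence, the model produces the tokens of `out` one after the other. -/
def Generates [Fintype V] (ρ : ℝ → ℝ) (prompt out : List V) : Prop :=
  ∀ (k : ℕ) (hk : k < out.length), T.IsNext ρ (prompt ++ out.take k) out[k]

end Transformer

/-- `θ` is a fixed-point number with `p` fractional bits and absolute value at most `B`. -/
def FixedPoint (p : ℕ) (B θ : ℝ) : Prop :=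
  |θ| ≤ B ∧ ∃ z : ℤ, θ = z / 2 ^ p

/-- `ρ` is a way of rounding numbers of absolute value at most `B` with an error of at most
`2⁻ᵖ` (to nearest, to zero, up, down, fixed- or floating-point, or no rounding at all). -/
def IsRounding (p : ℕ) (B : ℝ) (ρ : ℝ → ℝ) : Prop :=
  ∀ y : ℝ, |y| ≤ B → |ρ y - y| ≤ 1 / 2 ^ p

/-! ## The Mersenne Twister -/

/-- Constants of a Mersenne Twister on `w`-bit words. The mask `upper` is arbitrary; the usual
choice is a block of leading ones. -/
structure MTParams (w : ℕ) where
  m : ℕ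
  upper : BitVec w
  a : BitVec w
  u : ℕ
  s : ℕ
  b : BitVec w
  t : ℕ
  c : BitVec w
  l : ℕ

namespace MTParams

variable {w : ℕ} (P : MTParams w)

/-- The complementary mask. -/
def lower : BitVec w := ~~~P.upper

/-- Extraction (tempering). -/
def temper (z : BitVec w) : BitVec w :=
  let y₁ := z ^^^ (z >>> P.u)
  let y₂ := y₁ ^^^ ((y₁ <<< P.s) &&& P.b)
  let y₃ := y₂ ^^^ ((y₂ <<< P.t) &&& P.c)
  y₃ ^^^ (y₃ >>> P.l)

variable {n : ℕ} [NeZero n]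

/-- Rotation (twist): the new word computed from the state `x` at index `i`.
Here `Fin.ofNat n j` is `j mod n`. -/
def rotate (x : Fin n → BitVec w) (i : ℕ) : BitVec w :=
  let t := (x (Fin.ofNat n i) &&& P.upper) ||| (x (Fin.ofNat n (i + 1)) &&& P.lower)
  x (Fin.ofNat n (i + P.m)) ^^^ (t >>> 1) ^^^ (if t.getLsbD 0 then P.a else 0#w)

/-- The state after `q` steps; step `i` overwrites the word at index `i mod n`. -/
def state (x : Fin n → BitVec w) : ℕ → Fin n → BitVec w
  | 0 => x
  | i + 1 => Function.update (state x i) (Fin.ofNat n i) (P.rotate (state x i) i)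

/-- The `i`-th generated pseudo-random number, `i = 0, 1, 2, …`. -/
def output (x : Fin n → BitVec w) (i : ℕ) : BitVec w :=
  P.temper (P.state x (i + 1) (Fin.ofNat n i))

end MTParams

/-! ## Tokens and the chain of thought -/

/-- A token is a `w`-bit number or the separator `⇒` (`none`). -/
abbrev Token (w : ℕ) : Type := Option (BitVec w)

/-- The binary representation of a token, least significant bit first, continued by zeros from
index `w` on; the separator is represented by zeros. -/
def bit {w : ℕ} : Token w → ℕ → ℝ
  | none, _ => 0
  | some v, c => if v.getLsbD c then 1 else 0

section CoT

variable {w n : ℕ}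

/-- `x₀ … x_{n-1} ⇒` -/
def prompt (x : Fin n → BitVec w) : List (Token w) :=
  (List.ofFn x).map some ++ [none]

/-- `y x₀ … x_{n-1} ⇒`, with `y` the `i`-th generated number, `x` the state after that step. -/
def cotBlock [NeZero n] (P : MTParams w) (x : Fin n → BitVec w) (i : ℕ) : List (Token w) :=
  some (P.output x i) :: ((List.ofFn (P.state x (i + 1))).map some ++ [none])

/-- The chain of thought that generates `N` numbers from the initial state `x`. -/
def cot [NeZero n] (P : MTParams w) (x : Fin n → BitVec w) (N : ℕ) : List (Token w) :=
  (List.range N).flatMap (cotBlock P x)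

end CoT

/-- The token `s` at position `j` enters the Transformer as `(φ(s), j, 1, 0, …, 0)`. -/
def BinaryInput {w d : ℕ} (T : Transformer (Token w) d) : Prop :=
  w + 2 ≤ d ∧ (∀ v (c : Fin d), T.embed v c = bit v c) ∧
  ∀ (j : ℕ) (c : Fin d),
    T.pos j c = if (c : ℕ) = w then (j : ℝ) else if (c : ℕ) = w + 1 then 1 else 0

/-- Whenever the model is about to produce the next token of `out`, the first `w` coordinates of
its output vector are the bits of that token up to an error `ε`. -/
def ApproximatesBits {w d : ℕ} (T : Transformer (Token w) d) (ρ : ℝ → ℝ) (ε : ℝ)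
    (prompt out : List (Token w)) : Prop :=
  ∀ (k : ℕ) (hk : k < out.length) (c : Fin d), (c : ℕ) < w →
    |T.final ρ (prompt ++ out.take k) c - bit out[k] c| ≤ ε

end MTTransformer

/-!
On words stored as bits, every step of the recursion and of tempering is a bounded number of
threshold operations: comparisons locate an index within the chain of thought, the exclusive or of
up to three bits is the parity of their sum, and a parity is an integer combination of rectifiers
`max z 0`. Three state words enter the twist and a fourth is to be copied if it is not the one
replaced; each is fetched by an attention layer whose integer scores have their unique maximum at
the position that holds the word. Hence the next token is computed exactly by a bounded number of
layers with hard attention, rectifiers and integer weights.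

Multiplying the scores and the arguments of `GeLU` by `2 ^ p` turns hard attention into softmax and
rectifiers into `GeLU`, up to errors of order `2⁻ᵖ`, like those of rounding. One layer magnifies an
existing error by at most a power of `R`, a polynomial in `n + N + w` that bounds all weights and
register contents. As there are seventeen layers whatever the parameters, a polynomial `2 ^ p` keeps
the final error below `ε`.
-/

namespace MTTransformer

open Finset Matrix

/-! ## Rectifiers from GeLU -/

section Gelu

open ProbabilityTheory MeasureTheory

lemma mul_measureReal_abs_sub_integral_le_sqrt_variance {Ω : Type*} [MeasurableSpace Ω]
    {μ : Measure Ω} [IsProbabilityMeasure μ] {X : Ω → ℝ} (hX : MemLp X 2 μ) (t : ℝ) :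
    t * μ.real {ω | t ≤ |X ω - μ[X]|} ≤ √(Var[X; μ]) := by
  rcases le_or_gt t 0 with ht | ht
  · exact (mul_nonpos_of_nonpos_of_nonneg ht measureReal_nonneg).trans (Real.sqrt_nonneg _)
  have hcheb : μ.real {ω | t ≤ |X ω - μ[X]|} ≤ Var[X; μ] / t ^ 2 :=
    ENNReal.toReal_le_of_le_ofReal (div_nonneg (variance_nonneg _ _) (by positivity))
      (meas_ge_le_variance_div_sq hX ht)
  rw [le_div_iff₀ (by positivity)] at hcheb
  refine Real.le_sqrt_of_sq_le ?_
  calc (t * μ.real {ω | t ≤ |X ω - μ[X]|}) ^ 2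
      = μ.real {ω | t ≤ |X ω - μ[X]|} * t ^ 2 * μ.real {ω | t ≤ |X ω - μ[X]|} := by ring
    _ ≤ Var[X; μ] * 1 :=
        mul_le_mul hcheb measureReal_le_one measureReal_nonneg (variance_nonneg _ _)
    _ = Var[X; μ] := mul_one _

lemma mul_gaussianReal_le_one_of_subset {t : ℝ} {s : Set ℝ} (ht : 0 ≤ t) (hs : ∀ z ∈ s, t ≤ |z|) :
    t * (gaussianReal 0 1).real s ≤ 1 := by
  have htail := mul_measureReal_abs_sub_integral_le_sqrt_variance
    (memLp_id_gaussianReal (μ := 0) (v := 1) 2) t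
  simp only [id_eq, integral_id_gaussianReal, sub_zero, variance_id_gaussianReal, NNReal.coe_one,
    Real.sqrt_one] at htail
  exact (mul_le_mul_of_nonneg_left (measureReal_mono hs) ht).trans htail

lemma abs_gelu_sub_max_le_one (x : ℝ) : |gelu x - max 0 x| ≤ 1 := by
  rw [gelu, cdf_eq_real]
  rcases le_total 0 x with hx | hx
  · have hcompl :
        (gaussianReal 0 1).real (Set.Iic x) = 1 - (gaussianReal 0 1).real (Set.Ioi x) := by
      rw [← probReal_compl_eq_one_sub measurableSet_Ioi, Set.compl_Ioi]
    rw [hcompl, max_eq_right hx, mul_sub, mul_one, sub_sub_cancel_left, abs_neg,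
      abs_of_nonneg (mul_nonneg hx measureReal_nonneg)]
    exact mul_gaussianReal_le_one_of_subset hx fun z hz => (le_of_lt hz).trans (le_abs_self z)
  · rw [max_eq_left hx, sub_zero, abs_mul, abs_of_nonneg (a := Measure.real _ _) measureReal_nonneg]
    exact mul_gaussianReal_le_one_of_subset (abs_nonneg x) fun z hz =>
      abs_le_abs_of_nonpos hx (Set.mem_Iic.1 hz)

end Gelu

/-! ## Rounding -/

lemma IsRounding.abs_sub_le_add {p : ℕ} {B δ y z : ℝ} {ρ : ℝ → ℝ} (hρ : IsRounding p B ρ)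
    (hyz : |y - z| ≤ δ) (hz : |z| + δ ≤ B) : |ρ y - z| ≤ δ + 1 / 2 ^ p := by
  have hy : |y| ≤ B := by linarith [abs_sub_abs_le_abs_sub y z]
  linarith [abs_sub_le (ρ y) y z, hρ y hy]

lemma IsRounding.abs_gelu_div_sub_max_le {p : ℕ} {B t : ℝ} {ρ : ℝ → ℝ} (hρ : IsRounding p B ρ)
    (ht : 2 ^ p * |t| + 1 ≤ B) : |ρ (gelu (2 ^ p * t)) / 2 ^ p - max 0 t| ≤ 2 / 2 ^ p := by
  have hp : (0 : ℝ) < 2 ^ p := by positivity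
  have hunit : (1 : ℝ) / 2 ^ p ≤ 1 := (div_le_one hp).2 (one_le_pow₀ one_le_two)
  have hmax : max 0 (2 ^ p * t) = 2 ^ p * max 0 t := by
    rw [mul_max_of_nonneg _ _ hp.le, mul_zero]
  have hrange : |2 ^ p * max 0 t| + 1 ≤ B := by
    rw [abs_mul, abs_of_pos hp, abs_of_nonneg (le_max_left 0 t)]
    have : max 0 t ≤ |t| := max_le (abs_nonneg t) (le_abs_self t)
    nlinarith
  have hround := hρ.abs_sub_le_add (hmax ▸ abs_gelu_sub_max_le_one (2 ^ p * t)) hrange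
  rw [div_sub' hp.ne', abs_div, abs_of_pos hp]
  gcongr
  linarith

lemma fixedPoint_zero_intCast {R : ℕ} {z : ℤ} (hz : |z| ≤ R) : FixedPoint 0 R z :=
  ⟨by exact_mod_cast hz, z, by simp⟩

namespace FixedPoint

variable {p : ℕ} {R B θ : ℝ}

lemma of_zero (h : FixedPoint 0 R θ) (hB : R ≤ B) : FixedPoint p B θ := by
  obtain ⟨hθ, z, rfl⟩ := h
  exact ⟨hθ.trans hB, z * 2 ^ p, by push_cast; field_simp⟩

lemma two_pow_mul (h : FixedPoint 0 R θ) (hB : 2 ^ p * R ≤ B) : FixedPoint p B (2 ^ p * θ) := by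
  refine of_zero (R := 2 ^ p * R) ?_ hB
  obtain ⟨hθ, z, rfl⟩ := h
  refine ⟨?_, 2 ^ p * z, by push_cast; ring⟩
  rw [abs_mul, abs_of_pos (by positivity)]
  gcongr

lemma two_pow_inv_mul (h : FixedPoint 0 R θ) (hB : R ≤ B) : FixedPoint p B ((2 ^ p)⁻¹ * θ) := by
  obtain ⟨hθ, z, rfl⟩ := h
  refine ⟨?_, z, by simp [inv_mul_eq_div]⟩
  rw [abs_mul, abs_of_pos (by positivity)]
  exact (mul_le_of_le_one_left (abs_nonneg _)
    (inv_le_one_of_one_le₀ (one_le_pow₀ one_le_two))).trans (hθ.trans hB)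

end FixedPoint

/-! ## Perturbation of linear and bilinear forms -/

/-- The vector `x` approximates `y` with error `η` in each coordinate, and the coordinates of `y`
are at most `R` in absolute value. -/
def Tracks {ι : Type*} (R η : ℝ) (x y : ι → ℝ) : Prop :=
  ∀ c, |x c - y c| ≤ η ∧ |y c| ≤ R

section Perturbation

variable {ι κ : Type*} [Fintype ι]

lemma abs_dotProduct_le {x y : ι → ℝ} {a b K : ℝ} (ha : 0 ≤ a) (hb : 0 ≤ b)
    (hK : Fintype.card ι ≤ K) (hx : ∀ i, |x i| ≤ a) (hy : ∀ i, |y i| ≤ b) :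
    |x ⬝ᵥ y| ≤ K * (a * b) := by
  calc |∑ i, x i * y i| ≤ ∑ i, |x i * y i| := abs_sum_le_sum_abs _ _
    _ ≤ ∑ _i : ι, a * b := sum_le_sum fun i _ => by
        rw [abs_mul]; exact mul_le_mul (hx i) (hy i) (abs_nonneg _) ha
    _ = Fintype.card ι * (a * b) := by simp
    _ ≤ K * (a * b) := by gcongr

namespace Tracks

variable {R η K : ℝ} {x y : ι → ℝ}

omit [Fintype ι] in
lemma abs_le (h : Tracks R η x y) (c : ι) : |x c| ≤ R + η := by
  linarith [abs_sub_abs_le_abs_sub (x c) (y c), (h c).1, (h c).2]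

lemma dotProduct {S ζ : ℝ} {x' y' : ι → ℝ} (h : Tracks R η x y) (h' : Tracks S ζ x' y')
    (hR : 0 ≤ R) (hη : 0 ≤ η) (hS : 0 ≤ S) (hζ : 0 ≤ ζ) (hK : Fintype.card ι ≤ K) :
    |x ⬝ᵥ x' - y ⬝ᵥ y'| ≤ K * (η * (S + ζ) + R * ζ) := by
  have hsplit : x ⬝ᵥ x' - y ⬝ᵥ y' = (x - y) ⬝ᵥ x' + y ⬝ᵥ (x' - y') := by
    rw [sub_dotProduct, dotProduct_sub]; ring
  rw [hsplit, mul_add]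
  exact (abs_add_le _ _).trans (add_le_add
    (abs_dotProduct_le hη (by positivity) hK (fun c => (h c).1) h'.abs_le)
    (abs_dotProduct_le hR hζ hK (fun c => (h c).2) fun c => (h' c).1))

lemma vecMul {S : ℝ} {A : Matrix ι κ ℝ} (h : Tracks R η x y) (hR : 0 ≤ R) (hη : 0 ≤ η)
    (hS : 0 ≤ S) (hK : Fintype.card ι ≤ K) (hA : ∀ a u, |A a u| ≤ S) :
    Tracks (K * (R * S)) (K * (η * S)) (x ᵥ* A) (y ᵥ* A) := by
  refine fun u => ⟨?_, abs_dotProduct_le hR hS hK (fun c => (h c).2) fun a => hA a u⟩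
  rw [← Pi.sub_apply, ← sub_vecMul]
  exact abs_dotProduct_le hη hS hK (fun c => (h c).1) fun a => hA a u

end Tracks

end Perturbation

/-! ## Softmax averages -/

/-- The mean of the values `v` over `s`, with the softmax weights of the scores `f`. -/
noncomputable def softmaxMean {ι : Type*} (s : Finset ι) (f v : ι → ℝ) : ℝ :=
  ∑ j ∈ s, Real.exp (f j) / (∑ j' ∈ s, Real.exp (f j')) * v j

section SoftmaxMean

variable {ι : Type*} {s : Finset ι} {f v : ι → ℝ} {τ : ι} {g : ℝ}

lemma exp_div_sum_exp_le_one (hτ : τ ∈ s) :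
    Real.exp (f τ) / ∑ j ∈ s, Real.exp (f j) ≤ 1 :=
  div_le_one_of_le₀ (single_le_sum (fun j _ => (Real.exp_pos (f j)).le) hτ)
    (sum_nonneg fun j _ => (Real.exp_pos (f j)).le)

lemma exp_div_sum_exp_le_inv (hτ : τ ∈ s) (hg : 0 < g) {i : ι} (hi : f i + g ≤ f τ) :
    Real.exp (f i) / ∑ j ∈ s, Real.exp (f j) ≤ g⁻¹ := by
  calc Real.exp (f i) / ∑ j ∈ s, Real.exp (f j)
      ≤ Real.exp (f i) / Real.exp (f τ) := by
        gcongr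
        exact single_le_sum (fun j _ => (Real.exp_pos (f j)).le) hτ
    _ = Real.exp (f i - f τ) := (Real.exp_sub _ _).symm
    _ ≤ Real.exp (-g) := Real.exp_le_exp.2 (by linarith)
    _ = (Real.exp g)⁻¹ := Real.exp_neg g
    _ ≤ g⁻¹ := by gcongr; linarith [Real.add_one_le_exp g]

lemma softmaxMean_sub (hs : s.Nonempty) (t : ℝ) :
    softmaxMean s f v - t = softmaxMean s f fun j => v j - t := by
  have hZ : (∑ j ∈ s, Real.exp (f j)) ≠ 0 := (sum_pos (fun j _ => Real.exp_pos (f j)) hs).ne'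
  simp only [softmaxMean, mul_sub, sum_sub_distrib, ← sum_mul, ← sum_div, div_self hZ, one_mul]

lemma abs_softmaxMean_sub_le {a b t : ℝ} (hτ : τ ∈ s) (hg : 0 < g)
    (hgap : ∀ j ∈ s, j ≠ τ → f j + g ≤ f τ) (ha : |v τ - t| ≤ a) (hb : ∀ j ∈ s, |v j - t| ≤ b) :
    |softmaxMean s f v - t| ≤ a + #s * (b / g) := by
  classical
  have hweight (j : ι) : 0 ≤ Real.exp (f j) / ∑ j' ∈ s, Real.exp (f j') :=
    div_nonneg (Real.exp_pos _).le (sum_nonneg fun j _ => (Real.exp_pos (f j)).le)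
  have hb0 : 0 ≤ b := (abs_nonneg _).trans (hb τ hτ)
  rw [softmaxMean_sub ⟨τ, hτ⟩, softmaxMean, ← add_sum_erase s _ hτ]
  refine (abs_add_le _ _).trans (add_le_add ?_ ?_)
  · rw [abs_mul, abs_of_nonneg (hweight τ)]
    exact (mul_le_of_le_one_left (abs_nonneg _) (exp_div_sum_exp_le_one hτ)).trans ha
  refine (abs_sum_le_sum_abs _ _).trans ((sum_le_card_nsmul _ _ (b / g) fun j hj => ?_).trans ?_)
  · obtain ⟨hne, hj⟩ := mem_erase.1 hj
    rw [abs_mul, abs_of_nonneg (hweight j), div_eq_inv_mul b]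
    exact mul_le_mul (exp_div_sum_exp_le_inv hτ hg (hgap j hj hne)) (hb j hj) (abs_nonneg _)
      (by positivity)
  · rw [nsmul_eq_mul]
    gcongr
    exact erase_subset τ s

end SoftmaxMean

/-! ## Sharp layers -/

/-- A single-head layer: `M` is the bilinear form of the attention scores, `V` the value map, `A`
and `C` are the two maps of the feed-forward network. Scores and hidden units are scaled by `Λ`,
which sharpens the softmax and turns `GeLU` into a rectifier. -/
noncomputable def sharpLayer {d : ℕ} (Λ : ℝ) (M V A C : Matrix (Fin d) (Fin d) ℝ) : Layer d where
  H := 1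
  dk := d
  heads := one_mul d
  WQ _ := Λ • M
  WK _ := 1
  WV _ := V
  WO _ := 1
  W1 := Λ • A
  b1 := 0
  W2 := Λ⁻¹ • C

/-- `ρ` rounds with an error of at most `2⁻ᵖ` on a range that accommodates the intermediate
results of `sharpLayer (2 ^ p)` for vectors and matrices with entries at most `R`. -/
structure Precise (p : ℕ) (B R : ℝ) (ρ : ℝ → ℝ) : Prop where
  isRounding : IsRounding p B ρ
  nine_le : 9 ≤ R
  range : 2 ^ p * R ^ 4 ≤ B

section SharpLayer

variable {d L : ℕ} {Λ : ℝ} {M V A C : Matrix (Fin d) (Fin d) ℝ}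

lemma score_sharpLayer (X : Fin L → Fin d → ℝ) (h : Fin 1) (i j : Fin L) :
    (sharpLayer Λ M V A C).score X h i j = Λ * (X i ᵥ* M ⬝ᵥ X j) / √d := by
  have hscore : (sharpLayer Λ M V A C).score X h i j = (X i ᵥ* (Λ • M) ⬝ᵥ X j ᵥ* 1) / √d := rfl
  rw [hscore, vecMul_one, vecMul_smul, smul_dotProduct, smul_eq_mul]

lemma attention_sharpLayer (X : Fin L → Fin d → ℝ) (i : Fin L) (c : Fin d) :
    (sharpLayer Λ M V A C).attention X i c =
      softmaxMean (Iic i) (fun j => Λ * (X i ᵥ* M ⬝ᵥ X j) / √d) fun j => (X j ᵥ* V) c := by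
  have hhead : (sharpLayer Λ M V A C).attention X i = ∑ h : Fin 1,
      (∑ j ∈ Iic i, (sharpLayer Λ M V A C).attnWeight X h i j • X j ᵥ* V) ᵥ* 1 := rfl
  simp only [hhead, univ_unique, sum_singleton, vecMul_one, Layer.attnWeight, score_sharpLayer,
    Finset.sum_apply, Pi.smul_apply, smul_eq_mul, softmaxMean]

lemma ffn_sharpLayer (ρ : ℝ → ℝ) (x : Fin d → ℝ) :
    (sharpLayer Λ M V A C).ffn ρ x =
      (fun u => ρ (gelu (Λ * (x ᵥ* A) u)) / Λ) ᵥ* C := by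
  simp only [Layer.ffn, sharpLayer, vecMul_smul, add_zero, Pi.smul_apply, smul_eq_mul]
  rw [← smul_vecMul]
  congr 1
  ext u
  simp only [Pi.smul_apply, smul_eq_mul, div_eq_inv_mul]

lemma allParams_sharpLayer {p : ℕ} {R B : ℝ} (hM : ∀ i j, FixedPoint 0 R (M i j))
    (hV : ∀ i j, FixedPoint 0 R (V i j)) (hA : ∀ i j, FixedPoint 0 R (A i j))
    (hC : ∀ i j, FixedPoint 0 R (C i j)) (hR : 1 ≤ R) (hB : 2 ^ p * R ≤ B) :
    (sharpLayer (2 ^ p) M V A C).AllParams (FixedPoint p B) := by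
  have hRB : R ≤ B := (le_mul_of_one_le_left (by linarith) (one_le_pow₀ one_le_two)).trans hB
  have hzero : FixedPoint p B 0 :=
    FixedPoint.of_zero ⟨by simpa using zero_le_one.trans hR, 0, by simp⟩ hRB
  have hone (i j : Fin d) : FixedPoint p B ((1 : Matrix (Fin d) (Fin d) ℝ) i j) := by
    rw [one_apply]
    split_ifs
    · exact FixedPoint.of_zero ⟨by simpa using hR, 1, by simp⟩ hRB
    · exact hzero
  exact ⟨fun _ i j => (hM i j).two_pow_mul hB, fun _ => hone, fun _ i j => (hV i j).of_zero hRB,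
    fun _ => hone, fun i j => (hA i j).two_pow_mul hB, fun _ => hzero,
    fun i j => (hC i j).two_pow_inv_mul hRB⟩

namespace Precise

variable {p : ℕ} {B R η : ℝ} {ρ : ℝ → ℝ}

lemma pow_four_le (hρ : Precise p B R ρ) : R ^ 4 ≤ B :=
  (le_mul_of_one_le_left (by have := hρ.nine_le; positivity) (one_le_pow₀ one_le_two)).trans
    hρ.range

lemma add_one_le (hρ : Precise p B R ρ) : R + 1 ≤ B := by
  have hR := hρ.nine_le
  have : R ≤ R ^ 3 := le_self_pow₀ (by linarith) (by norm_num)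
  nlinarith [hρ.pow_four_le]

lemma abs_hidden_sub_le (hρ : Precise p B R ρ) (hd : d ≤ R) (hη : 1 / 2 ^ p ≤ η) (hη1 : η ≤ 1)
    (hA : ∀ a u, |A a u| ≤ R) {x y : Fin d → ℝ} (hxy : Tracks R η x y) (u : Fin d) :
    |ρ (gelu (2 ^ p * (x ᵥ* A) u)) / 2 ^ p - max 0 ((y ᵥ* A) u)| ≤ (2 + R ^ 2) * η := by
  have hR := hρ.nine_le
  have hR0 : 0 ≤ R := by linarith
  have hη0 : 0 ≤ η := le_trans (by positivity) hη
  have hpre : Tracks (R * (R * R)) (R * (η * R)) (x ᵥ* A) (y ᵥ* A) :=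
    hxy.vecMul hR0 hη0 hR0 (by simpa using hd) hA
  have hrange : 2 ^ p * |(x ᵥ* A) u| + 1 ≤ B := by
    have hone : (1 : ℝ) ≤ 2 ^ p := one_le_pow₀ one_le_two
    have habs : |(x ᵥ* A) u| + 1 ≤ R ^ 4 := by
      have hR3 : 0 < R ^ 3 := by positivity
      nlinarith [hpre.abs_le u]
    nlinarith [hρ.range]
  have hgelu := hρ.isRounding.abs_gelu_div_sub_max_le hrange
  have hmax : |max 0 ((x ᵥ* A) u) - max 0 ((y ᵥ* A) u)| ≤ R * (η * R) :=
    (abs_max_sub_max_le_max _ _ _ _).trans (max_le (by simpa using by positivity) (hpre u).1)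
  have hunit : 2 / 2 ^ p ≤ 2 * η := by rw [← mul_one_div]; gcongr
  linarith [abs_sub_le (ρ (gelu (2 ^ p * (x ᵥ* A) u)) / 2 ^ p) (max 0 ((x ᵥ* A) u))
    (max 0 ((y ᵥ* A) u))]

lemma abs_add_ffn_sub_le (hρ : Precise p B R ρ) (hd : d ≤ R) (hη : 1 / 2 ^ p ≤ η)
    (hη1 : R ^ 5 * η ≤ 1) (hA : ∀ a u, |A a u| ≤ R) (hC : ∀ u c, |C u c| ≤ R)
    {x y z : Fin d → ℝ} (hxy : Tracks R η x y) (hz : ∀ c, |z c| ≤ R)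
    (hyz : z = y + (fun u => max 0 ((y ᵥ* A) u)) ᵥ* C) (c : Fin d) :
    |ρ ((x + (sharpLayer (2 ^ p) M V A C).ffn ρ x) c) - z c| ≤ R ^ 5 * η := by
  have hR := hρ.nine_le
  have hη0 : 0 ≤ η := le_trans (by positivity) hη
  have hηle : η ≤ 1 := (le_mul_of_one_le_left hη0 (one_le_pow₀ (by linarith))).trans hη1
  have hffn : |((fun u => ρ (gelu (2 ^ p * (x ᵥ* A) u)) / 2 ^ p) ᵥ* C -
      (fun u => max 0 ((y ᵥ* A) u)) ᵥ* C) c| ≤ R * ((2 + R ^ 2) * η * R) := by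
    rw [← sub_vecMul]
    exact abs_dotProduct_le (by positivity) (by linarith) (by simpa using hd)
      (hρ.abs_hidden_sub_le hd hη hηle hA hxy) fun u => hC u c
  have hsum : |(x + (sharpLayer (2 ^ p) M V A C).ffn ρ x) c - z c| ≤
      η + R * ((2 + R ^ 2) * η * R) := by
    rw [ffn_sharpLayer, hyz, ← Pi.sub_apply, add_sub_add_comm]
    exact (abs_add_le _ _).trans (add_le_add (hxy c).1 hffn)
  have htotal : η + R * ((2 + R ^ 2) * η * R) + η ≤ R ^ 5 * η := by
    rw [show η + R * ((2 + R ^ 2) * η * R) + η = (2 + 2 * R ^ 2 + R ^ 4) * η by ring]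
    have hR2 : 81 ≤ R ^ 2 := by nlinarith
    have hR4 : 9 * R ^ 4 ≤ R ^ 5 := by rw [pow_succ R 4, mul_comm]; gcongr
    exact mul_le_mul_of_nonneg_right (by nlinarith) hη0
  refine (hρ.isRounding.abs_sub_le_add hsum ?_).trans (by linarith)
  linarith [hz c, hρ.add_one_le]

lemma abs_score_sub_le (hρ : Precise p B R ρ) (hd : d ≤ R) (hη0 : 0 ≤ η) (hη1 : R ^ 6 * η ≤ 1)
    (hM : ∀ a u, |M a u| ≤ R) {x x' y y' : Fin d → ℝ} (hxy : Tracks R η x y)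
    (hxy' : Tracks R η x' y') : |x ᵥ* M ⬝ᵥ x' - y ᵥ* M ⬝ᵥ y'| ≤ 1 / 4 := by
  have hR := hρ.nine_le
  have hR0 : 0 ≤ R := by linarith
  have hcard : (Fintype.card (Fin d) : ℝ) ≤ R := by simpa using hd
  have hηle : η ≤ 1 := (le_mul_of_one_le_left hη0 (one_le_pow₀ (by linarith))).trans hη1
  have hR2 : 81 ≤ R ^ 2 := by nlinarith
  have hquery : Tracks (R * (R * R)) (R * (η * R)) (x ᵥ* M) (y ᵥ* M) :=
    hxy.vecMul hR0 hη0 hR0 hcard hM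
  calc |x ᵥ* M ⬝ᵥ x' - y ᵥ* M ⬝ᵥ y'|
      ≤ R * (R * (η * R) * (R + η) + R * (R * R) * η) :=
        hquery.dotProduct hxy' (by positivity) (by positivity) hR0 hη0 hcard
    _ ≤ R * (R * (η * R) * (R + R) + R * (R * R) * η) := by gcongr; linarith
    _ = 3 * (R ^ 4 * η) := by ring
    _ ≤ 1 / 4 := by nlinarith [show 81 * (R ^ 4 * η) ≤ R ^ 2 * (R ^ 4 * η) by gcongr]

lemma scaled_score_gap (hρ : Precise p B R ρ) (hd : d ≤ R) (hη0 : 0 ≤ η) (hη1 : R ^ 6 * η ≤ 1)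
    (hM : ∀ a u, |M a u| ≤ R) {x x₁ x₂ y y₁ y₂ : Fin d → ℝ} (hxy : Tracks R η x y)
    (hxy₁ : Tracks R η x₁ y₁) (hxy₂ : Tracks R η x₂ y₂) (hd0 : 0 < d)
    (hgap : y ᵥ* M ⬝ᵥ y₁ + 1 ≤ y ᵥ* M ⬝ᵥ y₂) :
    2 ^ p * (x ᵥ* M ⬝ᵥ x₁) / √d + 2 ^ p / (2 * R) ≤ 2 ^ p * (x ᵥ* M ⬝ᵥ x₂) / √d := by
  have hd1 : (1 : ℝ) ≤ d := by exact_mod_cast hd0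
  have hsqrt : √(d : ℝ) ≤ R := (Real.sqrt_le_self_iff.2 (Or.inr hd1)).trans hd
  have : 0 < √(d : ℝ) := by positivity
  have hhalf : x ᵥ* M ⬝ᵥ x₁ + 1 / 2 ≤ x ᵥ* M ⬝ᵥ x₂ := by
    have h₁ := abs_le.1 (hρ.abs_score_sub_le hd hη0 hη1 hM hxy hxy₁)
    have h₂ := abs_le.1 (hρ.abs_score_sub_le hd hη0 hη1 hM hxy hxy₂)
    linarith [h₁.2, h₂.1]
  calc 2 ^ p * (x ᵥ* M ⬝ᵥ x₁) / √d + 2 ^ p / (2 * R)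
      ≤ 2 ^ p * (x ᵥ* M ⬝ᵥ x₁) / √d + 2 ^ p / (2 * √d) := by gcongr
    _ = 2 ^ p * (x ᵥ* M ⬝ᵥ x₁ + 1 / 2) / √d := by field_simp
    _ ≤ 2 ^ p * (x ᵥ* M ⬝ᵥ x₂) / √d := by gcongr

section Fetch

variable {X Y : Fin L → Fin d → ℝ} {i τ : Fin L}

lemma abs_attention_sub_le (hρ : Precise p B R ρ) (hd : d ≤ R) (hL : L ≤ R) (hη : 1 / 2 ^ p ≤ η)
    (hη1 : R ^ 6 * η ≤ 1) (hM : ∀ a u, |M a u| ≤ R) (hV : ∀ a u, |V a u| ≤ R)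
    (hXY : ∀ j, Tracks R η (X j) (Y j)) (hτ : τ ≤ i)
    (hgap : ∀ j ≤ i, j ≠ τ → Y i ᵥ* M ⬝ᵥ Y j + 1 ≤ Y i ᵥ* M ⬝ᵥ Y τ) (c : Fin d) :
    |(sharpLayer (2 ^ p) M V A C).attention X i c - (Y τ ᵥ* V) c| ≤ (R ^ 2 + 6 * R ^ 5) * η := by
  have hR := hρ.nine_le
  have hR0 : 0 ≤ R := by linarith
  have hη0 : 0 ≤ η := le_trans (by positivity) hη
  have hηle : η ≤ 1 := (le_mul_of_one_le_left hη0 (one_le_pow₀ (by linarith))).trans hη1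
  have hval (j : Fin L) : Tracks (R * (R * R)) (R * (η * R)) (X j ᵥ* V) (Y j ᵥ* V) :=
    (hXY j).vecMul hR0 hη0 hR0 (by simpa using hd) hV
  have hdist (j : Fin L) : |(X j ᵥ* V) c - (Y τ ᵥ* V) c| ≤ 3 * R ^ 3 := by
    have hclose : R * (η * R) ≤ R * (R * R) := by gcongr; linarith
    have hj := abs_le.1 ((hval j).abs_le c)
    have hτ := abs_le.1 (hval τ c).2
    rw [abs_le]
    constructor <;> linarith [hj.1, hj.2, hτ.1, hτ.2]
  rw [attention_sharpLayer]
  calc _ ≤ R * (η * R) + #(Iic i) * (3 * R ^ 3 / (2 ^ p / (2 * R))) :=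
        abs_softmaxMean_sub_le (mem_Iic.2 hτ) (by positivity)
          (fun j hj hne => hρ.scaled_score_gap hd hη0 hη1 hM (hXY i) (hXY j) (hXY τ) c.pos
            (hgap j (mem_Iic.1 hj) hne))
          (hval τ c).1 fun j _ => hdist j
    _ ≤ R * (η * R) + R * (3 * R ^ 3 / (2 ^ p / (2 * R))) := by
        gcongr
        refine le_trans ?_ hL
        exact_mod_cast (card_le_univ _).trans_eq (Fintype.card_fin L)
    _ = R ^ 2 * η + 6 * R ^ 5 * (1 / 2 ^ p) := by field_simp; ring
    _ ≤ R ^ 2 * η + 6 * R ^ 5 * η := by gcongr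
    _ = (R ^ 2 + 6 * R ^ 5) * η := by ring

lemma tracks_attnRes_of_gap (hρ : Precise p B R ρ) (hd : d ≤ R) (hL : L ≤ R) (hη : 1 / 2 ^ p ≤ η)
    (hη1 : R ^ 6 * η ≤ 1) (hM : ∀ a u, |M a u| ≤ R) (hV : ∀ a u, |V a u| ≤ R)
    (hXY : ∀ j, Tracks R η (X j) (Y j)) (hτ : τ ≤ i)
    (hgap : ∀ j ≤ i, j ≠ τ → Y i ᵥ* M ⬝ᵥ Y j + 1 ≤ Y i ᵥ* M ⬝ᵥ Y τ)
    (hz : ∀ c, |(Y i + Y τ ᵥ* V) c| ≤ R) :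
    Tracks R (R ^ 6 * η) ((sharpLayer (2 ^ p) M V A C).attnRes ρ X i) (Y i + Y τ ᵥ* V) := by
  intro c
  refine ⟨?_, hz c⟩
  have hR := hρ.nine_le
  have hη0 : 0 ≤ η := le_trans (by positivity) hη
  have hsum : |((sharpLayer (2 ^ p) M V A C).attention X i + X i) c - (Y i + Y τ ᵥ* V) c| ≤
      η + (R ^ 2 + 6 * R ^ 5) * η := by
    rw [Pi.add_apply, Pi.add_apply, add_comm, add_sub_add_comm]
    exact (abs_add_le _ _).trans (add_le_add (hXY i c).1
      (hρ.abs_attention_sub_le hd hL hη hη1 hM hV hXY hτ hgap c))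
  have htotal : η + (R ^ 2 + 6 * R ^ 5) * η + η ≤ R ^ 6 * η := by
    rw [show η + (R ^ 2 + 6 * R ^ 5) * η + η = (2 + R ^ 2 + 6 * R ^ 5) * η by ring]
    have hR2 : 81 ≤ R ^ 2 := by nlinarith
    have hR5 : R ^ 2 ≤ R ^ 5 := pow_le_pow_right₀ (by linarith) (by norm_num)
    have hR6 : 9 * R ^ 5 ≤ R ^ 6 := by rw [pow_succ R 5, mul_comm]; gcongr
    exact mul_le_mul_of_nonneg_right (by linarith) hη0
  refine (hρ.isRounding.abs_sub_le_add hsum ?_).trans (by linarith)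
  linarith [hz c, hρ.add_one_le]

end Fetch

lemma tracks_attnRes_of_value_eq_zero (hρ : Precise p B R ρ) (hη : 1 / 2 ^ p ≤ η)
    (hη1 : R ^ 6 * η ≤ 1) {X : Fin L → Fin d → ℝ} {i : Fin L} {y : Fin d → ℝ}
    (hXy : Tracks R η (X i) y) :
    Tracks R (R ^ 6 * η) ((sharpLayer (2 ^ p) M 0 A C).attnRes ρ X i) y := by
  intro c
  refine ⟨?_, (hXy c).2⟩
  have hR := hρ.nine_le
  have hη0 : 0 ≤ η := le_trans (by positivity) hη
  have hattention : ((sharpLayer (2 ^ p) M 0 A C).attention X i + X i) c = X i c := by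
    simp [attention_sharpLayer, softmaxMean]
  have hpow : 9 * η ≤ R ^ 6 * η := by
    gcongr
    exact hR.trans (le_self_pow₀ (by linarith) (by norm_num))
  rw [Layer.attnRes, hattention]
  refine (hρ.isRounding.abs_sub_le_add (hXy c).1 ?_).trans (by linarith)
  linarith [(hXy c).2, hρ.add_one_le]

end Precise

end SharpLayer

/-! ## Layers acting on integer registers -/

/-- Integer description of a layer acting on registers indexed by `σ`. A key `y` has score
`∑ b, (x ⬝ᵥ query b) * y b` for the query `x`; register `o` receives the linear form `value o` of
the position attended to, and four rectified linear forms `hidden o k` with coefficients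
`coeff o k`. -/
structure Gates (σ : Type) where
  query : σ → σ → ℤ
  value : σ → σ → ℤ
  hidden : σ → Fin 4 → σ → ℤ
  coeff : σ → Fin 4 → ℤ

/-- The hidden vector that holds the register contents `x`. Each register owns four coordinates,
one for each of its rectifiers, and is stored in the first of them. -/
def hiddenVec {σ : Type} {d : ℕ} (e : σ × Fin 4 ≃ Fin d) (x : σ → ℤ) (c : Fin d) : ℝ :=
  if (e.symm c).2 = 0 then x (e.symm c).1 else 0

section HiddenVec

variable {σ : Type} {d : ℕ} {e : σ × Fin 4 ≃ Fin d}

lemma hiddenVec_add (x y : σ → ℤ) : hiddenVec e (x + y) = hiddenVec e x + hiddenVec e y := by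
  ext c
  simp only [hiddenVec, Pi.add_apply]
  split_ifs <;> simp

lemma fixedPoint_hiddenVec {R : ℕ} {x : σ → ℤ} (hx : ∀ o, |x o| ≤ R) (c : Fin d) :
    FixedPoint 0 R (hiddenVec e x c) := by
  unfold hiddenVec
  split_ifs
  · exact fixedPoint_zero_intCast (hx _)
  · simpa using fixedPoint_zero_intCast (R := R) (z := 0) (by simp)

lemma hiddenVec_dotProduct [Fintype σ] (x : σ → ℤ) (f : Fin d → ℝ) :
    hiddenVec e x ⬝ᵥ f = ∑ o, x o * f (e (o, 0)) := by
  rw [dotProduct, ← e.sum_comp, Fintype.sum_prod_type]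
  exact sum_congr rfl fun o _ => by simp [hiddenVec]

lemma hiddenVec_dotProduct_intCast [Fintype σ] (x y : σ → ℤ) (f : Fin d → ℝ)
    (hf : ∀ o, f (e (o, 0)) = y o) : hiddenVec e x ⬝ᵥ f = (x ⬝ᵥ y : ℤ) := by
  rw [hiddenVec_dotProduct]
  simp [hf, dotProduct]

end HiddenVec

namespace Gates

variable {σ : Type} {d L : ℕ}

/-- All entries are at most `R` in absolute value. -/
structure Bounded (D : Gates σ) (R : ℕ) : Prop where
  query : ∀ b a, |D.query b a| ≤ R
  value : ∀ o a, |D.value o a| ≤ R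
  hidden : ∀ o k a, |D.hidden o k a| ≤ R
  coeff : ∀ o k, |D.coeff o k| ≤ R

section Step

variable [Fintype σ] (D : Gates σ)

/-- The score of the key `y` for the query `x`. -/
def score (x y : σ → ℤ) : ℤ := (fun b => x ⬝ᵥ D.query b) ⬝ᵥ y

/-- What the feed-forward sublayer adds to the registers `x` when `GeLU` is replaced by the
rectifier. -/
def rect (x : σ → ℤ) (o : σ) : ℤ := ∑ k, max 0 (x ⬝ᵥ D.hidden o k) * D.coeff o k

/-- The layer maps the exact register contents `X` to `Y`, either by its rectifiers or by fetching
values from the positions `τ i` of strictly largest score. -/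
inductive Step (X Y : Fin L → σ → ℤ) : Prop
  | rectify (hvalue : D.value = 0) (hY : ∀ i, Y i = X i + D.rect (X i)) : Step X Y
  | fetch (hcoeff : D.coeff = 0) (τ : Fin L → Fin L) (hτ : ∀ i, τ i ≤ i)
      (hmax : ∀ i, ∀ j ≤ i, j ≠ τ i → D.score (X i) (X j) < D.score (X i) (X (τ i)))
      (hY : ∀ i, Y i = X i + fun o => X (τ i) ⬝ᵥ D.value o) : Step X Y

end Step

section ToLayer

variable [DecidableEq σ] (e : σ × Fin 4 ≃ Fin d) (D : Gates σ)

/-- The matrix of the score form in the coordinates of the hidden vectors. -/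
def scoreMatrix : Matrix (Fin d) (Fin d) ℝ :=
  of fun c c' => (D.query (e.symm c').1 (e.symm c).1 : ℝ)

/-- The matrix of the value map in the coordinates of the hidden vectors. -/
def valueMatrix : Matrix (Fin d) (Fin d) ℝ :=
  of fun c => hiddenVec e fun o => D.value o (e.symm c).1

/-- The matrix of the rectified linear forms, one for each coordinate of the hidden vectors. -/
def hiddenMatrix : Matrix (Fin d) (Fin d) ℝ :=
  of fun c u => (D.hidden (e.symm u).1 (e.symm u).2 (e.symm c).1 : ℝ)

/-- The matrix that adds the rectified linear forms to their registers. -/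
def coeffMatrix : Matrix (Fin d) (Fin d) ℝ :=
  of fun u => hiddenVec e (Pi.single (e.symm u).1 (D.coeff (e.symm u).1 (e.symm u).2))

/-- The Transformer layer with scaling factor `Λ` described by `D`. -/
noncomputable def toLayer (Λ : ℝ) : Layer d :=
  sharpLayer Λ (D.scoreMatrix e) (D.valueMatrix e) (D.hiddenMatrix e) (D.coeffMatrix e)

variable {e D}

namespace Bounded

variable {R : ℕ}

omit [DecidableEq σ] in
lemma fixedPoint_scoreMatrix (hD : D.Bounded R) (c c' : Fin d) :
    FixedPoint 0 R (D.scoreMatrix e c c') :=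
  fixedPoint_zero_intCast (hD.query _ _)

omit [DecidableEq σ] in
lemma fixedPoint_valueMatrix (hD : D.Bounded R) (c c' : Fin d) :
    FixedPoint 0 R (D.valueMatrix e c c') :=
  fixedPoint_hiddenVec (fun o => hD.value o _) c'

omit [DecidableEq σ] in
lemma fixedPoint_hiddenMatrix (hD : D.Bounded R) (c u : Fin d) :
    FixedPoint 0 R (D.hiddenMatrix e c u) :=
  fixedPoint_zero_intCast (hD.hidden _ _ _)

lemma fixedPoint_coeffMatrix (hD : D.Bounded R) (u c : Fin d) :
    FixedPoint 0 R (D.coeffMatrix e u c) := by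
  refine fixedPoint_hiddenVec (fun o => ?_) c
  rw [Pi.single_apply]
  split_ifs
  · exact hD.coeff _ _
  · simp

lemma allParams_toLayer (hD : D.Bounded R) (hR : 1 ≤ R) {p : ℕ} {B : ℝ} (hB : 2 ^ p * R ≤ B) :
    (D.toLayer e (2 ^ p)).AllParams (FixedPoint p B) :=
  allParams_sharpLayer hD.fixedPoint_scoreMatrix hD.fixedPoint_valueMatrix
    hD.fixedPoint_hiddenMatrix hD.fixedPoint_coeffMatrix (by exact_mod_cast hR) hB

end Bounded

end ToLayer

section Exact

variable [Fintype σ] [DecidableEq σ] {e : σ × Fin 4 ≃ Fin d} (D : Gates σ)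

omit [DecidableEq σ] in
lemma vecMul_scoreMatrix_dotProduct (x y : σ → ℤ) :
    hiddenVec e x ᵥ* D.scoreMatrix e ⬝ᵥ hiddenVec e y = D.score x y := by
  rw [dotProduct_comm, hiddenVec_dotProduct_intCast y (fun b => x ⬝ᵥ D.query b),
    dotProduct_comm, score]
  exact fun o => hiddenVec_dotProduct_intCast _ _ _ fun a => by simp [scoreMatrix]

omit [DecidableEq σ] in
lemma vecMul_valueMatrix (x : σ → ℤ) :
    hiddenVec e x ᵥ* D.valueMatrix e = hiddenVec e fun o => x ⬝ᵥ D.value o := by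
  ext c
  rw [vecMul, hiddenVec_dotProduct]
  simp only [valueMatrix, of_apply, hiddenVec, Equiv.symm_apply_apply]
  split_ifs <;> simp [dotProduct]

omit [DecidableEq σ] in
lemma vecMul_hiddenMatrix (x : σ → ℤ) (u : Fin d) :
    (hiddenVec e x ᵥ* D.hiddenMatrix e) u = (x ⬝ᵥ D.hidden (e.symm u).1 (e.symm u).2 : ℤ) :=
  hiddenVec_dotProduct_intCast _ _ _ fun a => by simp [hiddenMatrix]

lemma vecMul_coeffMatrix (x : σ → ℤ) :
    (fun u => max 0 ((hiddenVec e x ᵥ* D.hiddenMatrix e) u)) ᵥ* D.coeffMatrix e =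
      hiddenVec e (D.rect x) := by
  ext c
  rw [vecMul, dotProduct, ← e.sum_comp, Fintype.sum_prod_type]
  simp only [vecMul_hiddenMatrix, coeffMatrix, of_apply, Equiv.symm_apply_apply, hiddenVec, rect]
  split_ifs
  · rw [Finset.sum_eq_single (e.symm c).1 (fun o _ ho => by simp [ho.symm])
      (by simp)]
    simp
  · simp

variable {D}

lemma exists_tracks_attnRes {p R : ℕ} {B η : ℝ} {ρ : ℝ → ℝ} (hρ : Precise p B R ρ)
    (hd : d ≤ R) (hL : L ≤ R) (hη : 1 / 2 ^ p ≤ η) (hη1 : (R : ℝ) ^ 6 * η ≤ 1)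
    (hD : D.Bounded R) {X Y : Fin L → σ → ℤ} (hXY : D.Step X Y) (hY : ∀ i o, |Y i o| ≤ R)
    {Z : Fin L → Fin d → ℝ} (hZ : ∀ i, Tracks R η (Z i) (hiddenVec e (X i))) (i : Fin L) :
    ∃ x, Y i = x + D.rect x ∧
      Tracks R (R ^ 6 * η) ((D.toLayer e (2 ^ p)).attnRes ρ Z i) (hiddenVec e x) := by
  rcases hXY with ⟨hvalue, hrect⟩ | ⟨hcoeff, τ, hτ, hmax, hfetch⟩
  · refine ⟨X i, hrect i, ?_⟩
    have hmatrix : D.valueMatrix e = 0 := by ext; simp [valueMatrix, hvalue, hiddenVec]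
    rw [toLayer, hmatrix]
    exact hρ.tracks_attnRes_of_value_eq_zero hη hη1 (hZ i)
  · refine ⟨Y i, by ext; simp [rect, hcoeff], ?_⟩
    have hY' : hiddenVec e (Y i) =
        hiddenVec e (X i) + hiddenVec e (X (τ i)) ᵥ* D.valueMatrix e := by
      rw [vecMul_valueMatrix, ← hiddenVec_add, hfetch i]
    rw [hY']
    refine hρ.tracks_attnRes_of_gap (by exact_mod_cast hd) (by exact_mod_cast hL) hη hη1
      (fun a u => (hD.fixedPoint_scoreMatrix a u).1) (fun a u => (hD.fixedPoint_valueMatrix a u).1)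
      hZ (hτ i) (fun j hj hne => ?_) fun c => ?_
    · simp only [vecMul_scoreMatrix_dotProduct]
      exact_mod_cast hmax i j hj hne
    · rw [← hY']
      exact (fixedPoint_hiddenVec (hY i) c).1

/-- The fixed polynomial loss of precision per layer is what makes logarithmic precision suffice
for a bounded number of layers. -/
lemma tracks_apply_toLayer {p R : ℕ} {B η : ℝ} {ρ : ℝ → ℝ} (hρ : Precise p B R ρ)
    (hd : d ≤ R) (hL : L ≤ R) (hη : 1 / 2 ^ p ≤ η) (hη1 : (R : ℝ) ^ 11 * η ≤ 1)
    (hD : D.Bounded R) {X Y : Fin L → σ → ℤ} (hXY : D.Step X Y) (hY : ∀ i o, |Y i o| ≤ R)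
    {Z : Fin L → Fin d → ℝ} (hZ : ∀ i, Tracks R η (Z i) (hiddenVec e (X i))) (i : Fin L) :
    Tracks R (R ^ 11 * η) ((D.toLayer e (2 ^ p)).apply ρ Z i) (hiddenVec e (Y i)) := by
  have hR : (1 : ℝ) ≤ R := by linarith [hρ.nine_le]
  have hη0 : 0 ≤ η := le_trans (by positivity) hη
  have hsplit : (R : ℝ) ^ 11 * η = R ^ 5 * (R ^ 6 * η) := by ring
  have hη6 : (R : ℝ) ^ 6 * η ≤ 1 :=
    (le_mul_of_one_le_left (by positivity) (one_le_pow₀ hR)).trans (hsplit ▸ hη1)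
  have hY' (c : Fin d) : |hiddenVec e (Y i) c| ≤ R := (fixedPoint_hiddenVec (hY i) c).1
  obtain ⟨x, hx, hattn⟩ := exists_tracks_attnRes hρ hd hL hη hη6 hD hXY hY hZ i
  rw [hsplit]
  refine fun c => ⟨?_, hY' c⟩
  refine hρ.abs_add_ffn_sub_le (by exact_mod_cast hd)
    (hη.trans (le_mul_of_one_le_left hη0 (one_le_pow₀ hR))) (hsplit ▸ hη1)
    (fun a u => (hD.fixedPoint_hiddenMatrix a u).1) (fun u c => (hD.fixedPoint_coeffMatrix u c).1)
    hattn hY' ?_ c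
  rw [vecMul_coeffMatrix, ← hiddenVec_add, hx]

lemma tracks_foldl_toLayer {p R K : ℕ} {B : ℝ} {ρ : ℝ → ℝ} (hρ : Precise p B R ρ) (hd : d ≤ R)
    (hL : L ≤ R) (hp : (R : ℝ) ^ (11 * K) * (1 / 2 ^ p) ≤ 1) {D : ℕ → Gates σ}
    (hD : ∀ l < K, (D l).Bounded R) {X : ℕ → Fin L → σ → ℤ}
    (hX : ∀ l < K, (D l).Step (X l) (X (l + 1))) (hXR : ∀ l ≤ K, ∀ i o, |X l i o| ≤ R)
    {Z : Fin L → Fin d → ℝ} (hZ : ∀ i, Z i = hiddenVec e (X 0 i)) (i : Fin L) :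
    Tracks R (R ^ (11 * K) * (1 / 2 ^ p))
      (((List.range K).map fun l => (D l).toLayer e (2 ^ p)).foldl
        (fun Z lay => lay.apply ρ Z) Z i) (hiddenVec e (X K i)) := by
  have hR : (1 : ℝ) ≤ R := by linarith [hρ.nine_le]
  induction K generalizing i with
  | zero => exact fun c => ⟨by simp [hZ], (fixedPoint_hiddenVec (hXR 0 le_rfl i) c).1⟩
  | succ K ih =>
    have hpow : (R : ℝ) ^ (11 * (K + 1)) * (1 / 2 ^ p) =
        R ^ 11 * (R ^ (11 * K) * (1 / 2 ^ p)) := by ring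
    have hK : (R : ℝ) ^ (11 * K) * (1 / 2 ^ p) ≤ 1 :=
      (le_mul_of_one_le_left (by positivity) (one_le_pow₀ hR)).trans (hpow ▸ hp)
    have hprev := ih hK (fun l hl => hD l (by lia)) (fun l hl => hX l (by lia))
      fun l hl => hXR l (by lia)
    rw [List.range_succ, List.map_append, List.foldl_append, hpow]
    exact tracks_apply_toLayer hρ hd hL (le_mul_of_one_le_left (by positivity) (one_le_pow₀ hR))
      (hpow ▸ hp) (hD K K.lt_succ_self) (hX K K.lt_succ_self) (hXR (K + 1) le_rfl) hprev i

end Exact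

end Gates

/-! ## Registers -/

/-- The working registers come in twelve arrays, listed in the order in which the layers fill
them: the block and the place of the position (both one-hot), the three words that enter the twist,
the word to be copied, the twisted word, its four stages of tempering, and whether the twisted word
is to be written at this place. -/
inductive Slot
  | block | place | currentWord | followingWord | middleWord | copiedWord
  | newWord | temper₁ | temper₂ | temper₃ | temper | isNew
  deriving DecidableEq

instance : Fintype Slot where
  elems := {.block, .place, .currentWord, .followingWord, .middleWord, .copiedWord, .newWord,
    .temper₁, .temper₂, .temper₃, .temper, .isNew}
  complete k := by cases k <;> simp

/-- The number of the layer that fills the array. -/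
def Slot.layer : Slot → ℕ
  | block => 0
  | place => 1
  | currentWord => 2
  | followingWord => 3
  | middleWord => 4
  | copiedWord => 5
  | newWord => 6
  | temper₁ => 7
  | temper₂ => 8
  | temper₃ => 9
  | temper => 10
  | isNew => 11

lemma Slot.layer_lt (k : Slot) : k.layer < 12 := by
  cases k <;> simp [layer]

lemma Slot.layer_injective : Function.Injective Slot.layer := by
  intro k k' h
  cases k <;> cases k' <;> simp_all [layer]

/-- The common length of the arrays: it exceeds the numbers of blocks, of places in a block and of
bits in a word. -/
abbrev slotLength (n N w : ℕ) : ℕ := n + N + w + 2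

/-- The registers: the bits of the token, its position, the constant one, and the arrays. -/
abbrev Reg (n N w : ℕ) : Type := Fin (w + 2) ⊕ Slot × Fin (slotLength n N w)

/-- The hidden dimension: four coordinates for each register. -/
abbrev hiddenDim (n N w : ℕ) : ℕ := 4 * (w + 2 + 12 * slotLength n N w)

/-- The numbering of the coordinates of the hidden vectors; the first coordinates of the input
registers come first, as in the embedding. -/
noncomputable def regEquiv (n N w : ℕ) : Reg n N w × Fin 4 ≃ Fin (hiddenDim n N w) :=
  let slotEquiv : Slot ≃ Fin 12 := Fintype.equivFinOfCardEq rfl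
  let pairEquiv := (slotEquiv.prodCongr (Equiv.refl (Fin (slotLength n N w)))).trans finProdFinEquiv
  let registerEquiv := ((Equiv.refl (Fin (w + 2))).sumCongr pairEquiv).trans finSumFinEquiv
  (Equiv.prodComm _ _).trans (((Equiv.refl _).prodCongr registerEquiv).trans finProdFinEquiv)

lemma regEquiv_inl {n N w : ℕ} (c : Fin (w + 2)) :
    (regEquiv n N w (.inl c, 0) : ℕ) = c := by
  simp [regEquiv, finProdFinEquiv]

section Forms

variable {n N w : ℕ}

/-- The linear form that reads input register `c`. -/
def inputForm (c : ℕ) : Reg n N w → ℤ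
  | .inl c' => if c' = c then 1 else 0
  | .inr _ => 0

/-- The linear form with constant value `z`. -/
def constForm (z : ℤ) : Reg n N w → ℤ := z • inputForm (w + 1)

/-- The linear form on the array `k` with coefficients `f`. -/
def slotForm (k : Slot) (f : ℕ → ℤ) : Reg n N w → ℤ
  | .inl _ => 0
  | .inr (k', s) => if k' = k then f s else 0

/-- The linear form that reads entry `i` of the array `k`. -/
def read (k : Slot) (i : ℕ) : Reg n N w → ℤ :=
  slotForm k fun s => if s = i then 1 else 0

lemma dotProduct_inputForm (x : Reg n N w → ℤ) (c : Fin (w + 2)) :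
    x ⬝ᵥ inputForm c = x (.inl c) := by
  simp [dotProduct, Fintype.sum_sum_type, inputForm, Fin.val_inj]

lemma dotProduct_slotForm (x : Reg n N w → ℤ) (k : Slot) (f : ℕ → ℤ) :
    x ⬝ᵥ slotForm k f = ∑ s, x (.inr (k, s)) * f s := by
  rw [dotProduct, Fintype.sum_sum_type, Fintype.sum_prod_type,
    Fintype.sum_eq_single k fun k' hk' => by simp [slotForm, hk']]
  simp [slotForm]

lemma dotProduct_slotForm_of_eq_single {x : Reg n N w → ℤ} {k : Slot} {g : ℕ}
    (hx : ∀ s, x (.inr (k, s)) = if s = g then 1 else 0) (hg : g < slotLength n N w) (f : ℕ → ℤ) :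
    x ⬝ᵥ slotForm k f = f g := by
  rw [dotProduct_slotForm, Fintype.sum_eq_single ⟨g, hg⟩ fun s hs => by
    simp [hx, show (s : ℕ) ≠ g from fun h => hs (Fin.ext h)]]
  simp [hx]

lemma dotProduct_read (x : Reg n N w → ℤ) (k : Slot) (i : ℕ) :
    x ⬝ᵥ read k i = if h : i < slotLength n N w then x (.inr (k, ⟨i, h⟩)) else 0 := by
  rw [read, dotProduct_slotForm]
  split_ifs with h
  · rw [Fintype.sum_eq_single ⟨i, h⟩ fun s hs => by
      simp [show (s : ℕ) ≠ i from fun h => hs (Fin.ext h)]]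
    simp
  · exact sum_eq_zero fun s _ => by simp [show (s : ℕ) ≠ i by lia]

lemma abs_inputForm_le (c : ℕ) (a : Reg n N w) : |inputForm c a| ≤ 1 := by
  unfold inputForm
  split
  · split_ifs <;> simp
  · simp

lemma abs_constForm_le (z : ℤ) (a : Reg n N w) : |constForm z a| ≤ |z| := by
  rw [constForm, Pi.smul_apply, smul_eq_mul, abs_mul]
  exact mul_le_of_le_one_right (abs_nonneg z) (abs_inputForm_le _ a)

lemma abs_slotForm_le {k : Slot} {f : ℕ → ℤ} {b : ℤ} (hb : 0 ≤ b)
    (hf : ∀ s < slotLength n N w, |f s| ≤ b) (a : Reg n N w) : |slotForm k f a| ≤ b := by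
  unfold slotForm
  split
  · simpa using hb
  · split_ifs
    · exact hf _ (Fin.is_lt _)
    · simpa using hb

lemma abs_read_le (k : Slot) (i : ℕ) (a : Reg n N w) : |read k i a| ≤ 1 :=
  abs_slotForm_le zero_le_one (fun s _ => by split_ifs <;> simp) a

end Forms

/-! ## The layout of the chain of thought -/

section Layout

/- Index `i` of the token sequence lies at place `r` of block `g` when `i + 2 = g * (n + 2) + r`
and `r < n + 2`. So every complete block is a separator, a generated number and a state, and the
prompt is block `0`, which lacks the first two places. -/

/-- The block that contains index `i`. -/
def blockOf (n i : ℕ) : ℕ := (i + 2) / (n + 2)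

/-- The place of index `i` in its block. -/
def placeOf (n i : ℕ) : ℕ := (i + 2) % (n + 2)

/-- The index at place `r` of the block that precedes the one of index `i`. -/
def previousIndex (n i r : ℕ) : ℕ := (blockOf n i - 1) * (n + 2) + r - 2

/-- The place of the state word with (cyclic) index `g - 1 + s`. In block `0`, where nothing is to
be computed, it is replaced by the place of the first token, which precedes all others. -/
def wordPlace (n s g : ℕ) : ℕ := if g = 0 then 2 else 2 + (g - 1 + s) % n

/-- The place in the preceding block of the state word that follows place `r`, clamped to the
places of state words. -/
def copyPlace (n r : ℕ) : ℕ := if r = 0 then 2 else if r = n + 1 then n + 1 else r + 1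

/-- The index of the state word that enters the twist with offset `s`. -/
def wordSource (n s i : ℕ) : ℕ := previousIndex n i (wordPlace n s (blockOf n i))

/-- The index of the token that is copied to index `i + 1` if no new word is to be written there. -/
def copySource (n i : ℕ) : ℕ :=
  previousIndex n i (if blockOf n i = 0 then 2 else copyPlace n (placeOf n i))

/-- The place before the one of the word that is replaced in block `g`. -/
def newPlace (n g : ℕ) : ℕ := 1 + (g - 1) % n

variable {n : ℕ}

lemma placeOf_lt (i : ℕ) : placeOf n i < n + 2 := Nat.mod_lt _ (by lia)

lemma blockOf_mul_add_placeOf (i : ℕ) : blockOf n i * (n + 2) + placeOf n i = i + 2 := by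
  rw [mul_comm]
  exact Nat.div_add_mod _ _

lemma blockOf_eq_and_placeOf_eq {i g r : ℕ} (hr : r < n + 2) (h : g * (n + 2) + r = i + 2) :
    blockOf n i = g ∧ placeOf n i = r := by
  rw [blockOf, placeOf, ← h, mul_comm, Nat.mul_add_div (by lia), Nat.mul_add_mod,
    Nat.div_eq_of_lt hr, Nat.mod_eq_of_lt hr]
  simp

lemma eq_of_blockOf_eq_of_placeOf_eq {i j : ℕ} (hblock : blockOf n i = blockOf n j)
    (hplace : placeOf n i = placeOf n j) : i = j := by
  have hi := blockOf_mul_add_placeOf (n := n) i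
  have hj := blockOf_mul_add_placeOf (n := n) j
  rw [hblock, hplace] at hi
  lia

lemma blockOf_previousIndex {i r : ℕ} (hr : 2 ≤ r) (hr' : r < n + 2) :
    blockOf n (previousIndex n i r) = blockOf n i - 1 :=
  (blockOf_eq_and_placeOf_eq hr' (Nat.sub_add_cancel (by lia)).symm).1

lemma placeOf_previousIndex {i r : ℕ} (hr : 2 ≤ r) (hr' : r < n + 2) :
    placeOf n (previousIndex n i r) = r :=
  (blockOf_eq_and_placeOf_eq hr' (Nat.sub_add_cancel (by lia)).symm).2

lemma previousIndex_le {i r : ℕ} (hr : r < n + 2) (hi : blockOf n i = 0 → r = 2) :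
    previousIndex n i r ≤ i := by
  have hblock := blockOf_mul_add_placeOf (n := n) i
  rw [previousIndex]
  rcases hg : blockOf n i with _ | g
  · simp [hi hg]
  · rw [hg, add_one_mul] at hblock
    lia

variable [NeZero n]

lemma wordPlace_mem (s g : ℕ) : 2 ≤ wordPlace n s g ∧ wordPlace n s g < n + 2 := by
  have hn := NeZero.pos n
  have hmod := Nat.mod_lt (g - 1 + s) hn
  unfold wordPlace
  split_ifs <;> lia

lemma copyPlace_mem {r : ℕ} (hr : r < n + 2) : 2 ≤ copyPlace n r ∧ copyPlace n r < n + 2 := by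
  have hn := NeZero.pos n
  unfold copyPlace
  split_ifs <;> lia

end Layout

/-! ## The exact computation -/

namespace MTParams

variable {w : ℕ} (P : MTParams w)

/-- The word made of the upper bits of `x` and the lower bits of `y`. -/
def mix (x y : BitVec w) : BitVec w := (x &&& P.upper) ||| (y &&& P.lower)

/-- The new word in terms of the words `x`, `y`, `z` at the indices `i`, `i + 1`, `i + m`. -/
def twist (x y z : BitVec w) : BitVec w :=
  z ^^^ (P.mix x y >>> 1) ^^^ (if (P.mix x y).getLsbD 0 then P.a else 0#w)

/-- The first stage of tempering. -/
def temper₁ (z : BitVec w) : BitVec w := z ^^^ (z >>> P.u)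

/-- The first two stages of tempering. -/
def temper₂ (z : BitVec w) : BitVec w := P.temper₁ z ^^^ ((P.temper₁ z <<< P.s) &&& P.b)

/-- The first three stages of tempering. -/
def temper₃ (z : BitVec w) : BitVec w := P.temper₂ z ^^^ ((P.temper₂ z <<< P.t) &&& P.c)

end MTParams

section Bits

variable {w : ℕ}

/-- A bit of a word as an integer; it is zero from index `w` on. -/
def intBit (v : BitVec w) (s : ℕ) : ℤ := if v.getLsbD s then 1 else 0

lemma intBit_eq_zero {v : BitVec w} {s : ℕ} (h : w ≤ s) : intBit v s = 0 := by
  simp [intBit, BitVec.getLsbD_of_ge v s h]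

lemma intBit_zero (s : ℕ) : intBit (0#w) s = 0 := by simp [intBit]

lemma intBit_nonneg (v : BitVec w) (s : ℕ) : 0 ≤ intBit v s := by
  unfold intBit; split_ifs <;> simp

lemma intBit_le_one (v : BitVec w) (s : ℕ) : intBit v s ≤ 1 := by
  unfold intBit; split_ifs <;> simp

lemma abs_intBit_le_one (v : BitVec w) (s : ℕ) : |intBit v s| ≤ 1 :=
  (abs_of_nonneg (intBit_nonneg v s)).trans_le (intBit_le_one v s)

lemma intBit_xor_xor (v₁ v₂ v₃ : BitVec w) (s : ℕ) :
    intBit (v₁ ^^^ v₂ ^^^ v₃) s = (intBit v₁ s + intBit v₂ s + intBit v₃ s) % 2 := by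
  simp only [intBit, BitVec.getLsbD_xor]
  cases v₁.getLsbD s <;> cases v₂.getLsbD s <;> cases v₃.getLsbD s <;> simp

lemma intBit_ushiftRight (v : BitVec w) (u s : ℕ) : intBit (v >>> u) s = intBit v (u + s) := by
  simp [intBit, BitVec.getLsbD_ushiftRight]

lemma intBit_shiftLeft_and (v b : BitVec w) (u s : ℕ) :
    intBit ((v <<< u) &&& b) s = if u ≤ s ∧ b.getLsbD s then intBit v (s - u) else 0 := by
  simp only [intBit, BitVec.getLsbD_and, BitVec.getLsbD_shiftLeft]
  grind [BitVec.lt_of_getLsbD]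

lemma intBit_mix (P : MTParams w) (x y : BitVec w) (s : ℕ) :
    intBit (P.mix x y) s = if P.upper.getLsbD s then intBit x s else intBit y s := by
  rcases lt_or_ge s w with hs | hs
  · simp only [intBit, MTParams.mix, MTParams.lower, BitVec.getLsbD_or, BitVec.getLsbD_and,
      BitVec.getLsbD_not, hs]
    cases P.upper.getLsbD s <;> simp
  · simp [intBit_eq_zero hs]

/-- The word of a token; the separator counts as zero. -/
def tokenWord (t : Token w) : BitVec w := t.getD 0#w

end Bits

section Values

variable {w : ℕ} (n N : ℕ) (P : MTParams w) (tok : ℕ → Token w)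

/-- The state word computed in the block of index `i` from the preceding block. -/
def newWord (i : ℕ) : BitVec w :=
  P.twist (tokenWord (tok (wordSource n 0 i))) (tokenWord (tok (wordSource n 1 i)))
    (tokenWord (tok (wordSource n P.m i)))

/-- The word predicted at index `i` for index `i + 1`. -/
def predictedWord (i : ℕ) : BitVec w :=
  if placeOf n i = 0 then P.temper (newWord n P tok i)
  else if placeOf n i = newPlace n (blockOf n i) then newWord n P tok i
  else if placeOf n i = n + 1 then 0#w
  else tokenWord (tok (copySource n i))

/-- The entry `s` of the array `k` at index `i`, once the array has been filled. -/
def slotValue (i : ℕ) : Slot → ℕ → ℤ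
  | .block, s => if s = blockOf n i then 1 else 0
  | .place, s => if s = placeOf n i then 1 else 0
  | .currentWord, s => intBit (tokenWord (tok (wordSource n 0 i))) s
  | .followingWord, s => intBit (tokenWord (tok (wordSource n 1 i))) s
  | .middleWord, s => intBit (tokenWord (tok (wordSource n P.m i))) s
  | .copiedWord, s => intBit (tokenWord (tok (copySource n i))) s
  | .newWord, s => intBit (newWord n P tok i) s
  | .temper₁, s => intBit (P.temper₁ (newWord n P tok i)) s
  | .temper₂, s => intBit (P.temper₂ (newWord n P tok i)) s
  | .temper₃, s => intBit (P.temper₃ (newWord n P tok i)) s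
  | .temper, s => intBit (P.temper (newWord n P tok i)) s
  | .isNew, _ => if placeOf n i = newPlace n (blockOf n i) then 1 else 0

/-- The contents of the registers at index `i` before layer `l`. The layers `0, …, 11` fill the
arrays, and layer `12` replaces the bits of the token by those of the predicted word. -/
def regs (l i : ℕ) : Reg n N w → ℤ
  | .inl c =>
    if (c : ℕ) < w then intBit (if l ≤ 12 then tokenWord (tok i) else predictedWord n P tok i) c
    else if (c : ℕ) = w then i + 1 else 1
  | .inr (k, s) => if k.layer < l then slotValue n P tok i k s else 0

end Values

section Read

variable {n N w : ℕ} {P : MTParams w} {tok : ℕ → Token w} {l i : ℕ}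

lemma regs_dotProduct_constForm (z : ℤ) : regs n N P tok l i ⬝ᵥ constForm z = z := by
  have h := dotProduct_inputForm (regs n N P tok l i) ⟨w + 1, by lia⟩
  rw [constForm, dotProduct_smul, h]
  simp [regs]

lemma regs_dotProduct_position : regs n N P tok l i ⬝ᵥ inputForm w = i + 1 := by
  have h := dotProduct_inputForm (regs n N P tok l i) ⟨w, by lia⟩
  rw [h]
  simp [regs]

lemma regs_dotProduct_block (hl : 0 < l) (hi : blockOf n i ≤ N) (f : ℕ → ℤ) :
    regs n N P tok l i ⬝ᵥ slotForm .block f = f (blockOf n i) :=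
  dotProduct_slotForm_of_eq_single (fun s => by simp [regs, Slot.layer, hl, slotValue])
    (by lia) f

lemma regs_dotProduct_place (hl : 1 < l) (f : ℕ → ℤ) :
    regs n N P tok l i ⬝ᵥ slotForm .place f = f (placeOf n i) :=
  dotProduct_slotForm_of_eq_single (fun s => by simp [regs, Slot.layer, hl, slotValue])
    (by have := placeOf_lt (n := n) i; lia) f

lemma regs_dotProduct_read {k : Slot} (hk : k.layer < l) {s : ℕ} (hs : s < slotLength n N w) :
    regs n N P tok l i ⬝ᵥ read k s = slotValue n P tok i k s := by
  rw [dotProduct_read, dif_pos hs]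
  simp [regs, hk]

lemma regs_dotProduct_read_intBit {k : Slot} (hk : k.layer < l) {v : BitVec w}
    (hv : ∀ s, slotValue n P tok i k s = intBit v s) (s : ℕ) :
    regs n N P tok l i ⬝ᵥ read k s = intBit v s := by
  by_cases hs : s < slotLength n N w
  · rw [regs_dotProduct_read hk hs, hv]
  · rw [dotProduct_read, dif_neg hs, intBit_eq_zero (by lia)]

lemma abs_slotValue_le (k : Slot) (s : ℕ) : |slotValue n P tok i k s| ≤ 1 := by
  have hite (p : Prop) [Decidable p] : |if p then (1 : ℤ) else 0| ≤ 1 := by split_ifs <;> simp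
  cases k <;> simp only [slotValue, abs_intBit_le_one, hite]

lemma abs_regs_le {R : ℕ} (hi : i + 1 ≤ R) (o : Reg n N w) : |regs n N P tok l i o| ≤ R := by
  rcases o with c | ⟨k, s⟩
  · simp only [regs]
    split_ifs
    · exact (abs_intBit_le_one _ _).trans (by lia)
    · exact (abs_intBit_le_one _ _).trans (by lia)
    · exact (abs_of_nonneg (by lia)).trans_le (by lia)
    · exact abs_one.trans_le (by lia)
  · simp only [regs]
    split_ifs
    · exact (abs_slotValue_le k s).trans (by lia)
    · simp

end Read

/-! ## The layers -/

section Layers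

variable {n N w : ℕ}

/-- The layer that fills the array `k`: its entry `s` receives the rectified forms `F s` with
coefficients `G`. -/
def rectifyGates (k : Slot) (F : ℕ → Fin 4 → Reg n N w → ℤ) (G : Fin 4 → ℤ) :
    Gates (Reg n N w) where
  query := 0
  value := 0
  hidden
    | .inl _ => 0
    | .inr (k', s) => if k' = k then F s else 0
  coeff
    | .inl _ => 0
    | .inr (k', _) => if k' = k then G else 0

/-- The layer that fills the array `k` with the parities of forms with values in `{0, 1, 2, 3}`. -/
def parityGates (k : Slot) (f : ℕ → Reg n N w → ℤ) : Gates (Reg n N w) :=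
  rectifyGates k (fun s => ![f s, f s - constForm 1, f s - constForm 2, 0]) ![1, -2, 2, 0]

/-- The layer that marks in the array `k` the zeros among the values of the forms `f`. -/
def zeroTestGates (k : Slot) (f : ℕ → Reg n N w → ℤ) : Gates (Reg n N w) :=
  rectifyGates k (fun s => ![f s + constForm 1, f s, f s - constForm 1, 0]) ![1, -2, 1, 0]

/-- The layer that fills the array `k` with a word of the preceding block. Of the places in that
block it chooses the place `r` for which `t g r + u q r` is maximal, where `g` and `q` are the
block and the place of the current index. -/
def fetchGates (k : Slot) (t u : ℕ → ℕ → ℤ) : Gates (Reg n N w) where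
  query
    | .inr (.block, g') => slotForm .block fun g => if g' = g - 1 then 1 else 0
    | .inr (.place, r) => slotForm .block (t · r) + slotForm .place (u · r)
    | _ => 0
  value
    | .inl _ => 0
    | .inr (k', s) => if k' = k ∧ (s : ℕ) < w then inputForm s else 0
  hidden := 0
  coeff := 0

/-- The form with value `i + 2 - s * (n + 2)` at index `i`; it is nonnegative up to the block of
`i`. -/
def blockForm (s : ℕ) : Reg n N w → ℤ := inputForm w + constForm (1 - s * (n + 2))

/-- The layer that computes the block. -/
def blockGates : Gates (Reg n N w) :=
  rectifyGates .block (fun s => ![blockForm s + constForm 1, blockForm s,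
    blockForm (s + 1) + constForm 1, blockForm (s + 1)]) ![1, -1, -1, 1]

/-- The layer that computes the place in the block. -/
def placeGates : Gates (Reg n N w) :=
  zeroTestGates .place fun s =>
    inputForm w + constForm (1 - s) - slotForm .block fun g => (g * (n + 2) : ℕ)

/-- The layer that fetches the state word that enters the twist with offset `s`. -/
def wordGates (k : Slot) (s : ℕ) : Gates (Reg n N w) :=
  fetchGates k (fun g r => if r = wordPlace n s g then 1 else 0) 0

/-- The layer that fetches the word to be copied. -/
def copyGates : Gates (Reg n N w) :=
  fetchGates .copiedWord (fun g r => if g = 0 ∧ r = 2 then 2 else 0)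
    fun q r => if r = copyPlace n q then 1 else 0

/-- The form that reads bit `s` of the mixture of the current and the following word. -/
def mixForm (P : MTParams w) (s : ℕ) : Reg n N w → ℤ :=
  if P.upper.getLsbD s then read .currentWord s else read .followingWord s

/-- The layer that computes the twist. -/
def twistGates (P : MTParams w) : Gates (Reg n N w) :=
  parityGates .newWord fun s => read .middleWord s + mixForm P (s + 1) +
    if P.a.getLsbD s then mixForm P 0 else 0

/-- The layer that computes `v ^^^ (v >>> u)` in the array `k'` for the word `v` in the
array `k`. -/
def shiftRightGates (k k' : Slot) (u : ℕ) : Gates (Reg n N w) :=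
  parityGates k' fun s => read k s + read k (u + s)

/-- The layer that computes `v ^^^ ((v <<< u) &&& b)` in the array `k'` for the word `v` in the
array `k`. -/
def shiftLeftGates (k k' : Slot) (u : ℕ) (b : BitVec w) : Gates (Reg n N w) :=
  parityGates k' fun s => read k s + if u ≤ s ∧ b.getLsbD s then read k (s - u) else 0

/-- The layer that tests whether the twisted word is to be written at this place. -/
def isNewGates : Gates (Reg n N w) :=
  zeroTestGates .isNew fun _ =>
    slotForm .place (fun r => (r : ℤ)) - slotForm .block fun g => (newPlace n g : ℤ)

/-- The forms that replace bit `s` of the token by that of the predicted word. The first three are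
nonzero only for the word selected by the place; the last one removes the token. -/
def outputForms (s : ℕ) : Fin 4 → Reg n N w → ℤ :=
  ![read .temper s + read .place 0 - constForm 1,
    read .newWord s + read .isNew 0 - constForm 1,
    read .copiedWord s - read .place 0 - read .isNew 0 - read .place (n + 1),
    inputForm s]

/-- The layer that writes the predicted word. -/
def outputGates : Gates (Reg n N w) where
  query := 0
  value := 0
  hidden
    | .inl c => if (c : ℕ) < w then outputForms c else 0
    | .inr _ => 0
  coeff
    | .inl c => if (c : ℕ) < w then ![1, 1, 1, -1] else 0
    | .inr _ => 0

/-- The layer that does nothing. -/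
def idleGates : Gates (Reg n N w) where
  query := 0
  value := 0
  hidden := 0
  coeff := 0

/-- The layers of the Transformer; the last four of the seventeen are idle. -/
def mtGates (n N : ℕ) (P : MTParams w) : ℕ → Gates (Reg n N w)
  | 0 => blockGates
  | 1 => placeGates
  | 2 => wordGates .currentWord 0
  | 3 => wordGates .followingWord 1
  | 4 => wordGates .middleWord P.m
  | 5 => copyGates
  | 6 => twistGates P
  | 7 => shiftRightGates .newWord .temper₁ P.u
  | 8 => shiftLeftGates .temper₁ .temper₂ P.s P.b
  | 9 => shiftLeftGates .temper₂ .temper₃ P.t P.c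
  | 10 => shiftRightGates .temper₃ .temper P.l
  | 11 => isNewGates
  | 12 => outputGates
  | _ => idleGates

end Layers

/-- The layer computes the register contents before layer `l + 1` from those before layer `l` at
all of the first `L` indices. -/
abbrev Gates.Advances (n N : ℕ) {w : ℕ} (D : Gates (Reg n N w)) (P : MTParams w)
    (tok : ℕ → Token w) (L l : ℕ) : Prop :=
  D.Step (fun i : Fin L => regs n N P tok l i) fun i : Fin L => regs n N P tok (l + 1) i

section Advances

variable {n N w L : ℕ} {P : MTParams w} {tok : ℕ → Token w}

lemma regs_layer_add_one (k : Slot) (i : ℕ) :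
    regs n N P tok (k.layer + 1) i = regs n N P tok k.layer i +
      Sum.elim (fun _ => 0) fun o => if o.1 = k then slotValue n P tok i k o.2 else 0 := by
  have hk := k.layer_lt
  ext (c | ⟨k', s⟩)
  · simp [regs, hk.le, show k.layer + 1 ≤ 12 by lia]
  · rcases eq_or_ne k' k with rfl | hne
    · simp [regs]
    · have hne' : k'.layer ≠ k.layer := Slot.layer_injective.ne hne
      simp [regs, hne, show k'.layer < k.layer + 1 ↔ k'.layer < k.layer by lia]

lemma advances_rectifyGates {k : Slot} {F : ℕ → Fin 4 → Reg n N w → ℤ} {G : Fin 4 → ℤ}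
    (h : ∀ i < L, ∀ s < slotLength n N w,
      ∑ j, max 0 (regs n N P tok k.layer i ⬝ᵥ F s j) * G j = slotValue n P tok i k s) :
    (rectifyGates k F G).Advances n N P tok L k.layer := by
  refine .rectify rfl fun i => ?_
  rw [regs_layer_add_one]
  congr 1
  ext (c | ⟨k', s⟩)
  · simp [Gates.rect, rectifyGates]
  · rcases eq_or_ne k' k with rfl | hne
    · simpa [Gates.rect, rectifyGates] using (h i i.is_lt s s.is_lt).symm
    · simp [Gates.rect, rectifyGates, hne]

lemma advances_parityGates_xor {k : Slot} {f : ℕ → Reg n N w → ℤ} {v₁ v₂ v₃ : ℕ → BitVec w}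
    (hf : ∀ i s, regs n N P tok k.layer i ⬝ᵥ f s =
      intBit (v₁ i) s + intBit (v₂ i) s + intBit (v₃ i) s)
    (hk : ∀ i s, slotValue n P tok i k s = intBit (v₁ i ^^^ v₂ i ^^^ v₃ i) s) :
    (parityGates k f).Advances n N P tok L k.layer := by
  have hparity (z : ℤ) (h₀ : 0 ≤ z) (h₃ : z ≤ 3) :
      max 0 z - max 0 (z - 1) * 2 + max 0 (z - 2) * 2 = z % 2 := by lia
  refine advances_rectifyGates fun i _ s _ => ?_
  have h₁ := intBit_nonneg (v₁ i) s
  have h₁' := intBit_le_one (v₁ i) s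
  have h₂ := intBit_nonneg (v₂ i) s
  have h₂' := intBit_le_one (v₂ i) s
  have h₃ := intBit_nonneg (v₃ i) s
  have h₃' := intBit_le_one (v₃ i) s
  rw [hk, intBit_xor_xor, ← hf, ← hparity _ (by rw [hf]; lia) (by rw [hf]; lia)]
  simp [Fin.sum_univ_four, regs_dotProduct_constForm, sub_eq_add_neg]

lemma advances_zeroTestGates {k : Slot} {f : ℕ → Reg n N w → ℤ}
    (h : ∀ i < L, ∀ s, slotValue n P tok i k s =
      if regs n N P tok k.layer i ⬝ᵥ f s = 0 then 1 else 0) :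
    (zeroTestGates k f).Advances n N P tok L k.layer := by
  have hzero (z : ℤ) :
      max 0 (z + 1) - max 0 z * 2 + max 0 (z - 1) = if z = 0 then 1 else 0 := by
    split_ifs <;> lia
  refine advances_rectifyGates fun i hi s _ => ?_
  rw [h i hi, ← hzero]
  simp [Fin.sum_univ_four, dotProduct_add, regs_dotProduct_constForm, sub_eq_add_neg]

lemma regs_dotProduct_blockForm (l i s : ℕ) :
    regs n N P tok l i ⬝ᵥ blockForm s = i + 2 - s * (n + 2) := by
  rw [blockForm, dotProduct_add, regs_dotProduct_position, regs_dotProduct_constForm]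
  ring

lemma advances_blockGates : blockGates.Advances n N P tok L 0 := by
  have hstep (z : ℤ) : max 0 (z + 1) - max 0 z = if 0 ≤ z then 1 else 0 := by
    split_ifs <;> lia
  have hthreshold (i s : ℕ) : (0 : ℤ) ≤ i + 2 - s * (n + 2) ↔ s ≤ blockOf n i := by
    rw [blockOf, Nat.le_div_iff_mul_le (by lia), sub_nonneg]
    exact_mod_cast Iff.rfl
  refine advances_rectifyGates (k := .block) fun i _ s _ => ?_
  calc _ = (if s ≤ blockOf n i then (1 : ℤ) else 0) - if s + 1 ≤ blockOf n i then 1 else 0 := by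
        rw [← if_congr (hthreshold i s) rfl rfl, ← if_congr (hthreshold i (s + 1)) rfl rfl,
          ← hstep, ← hstep]
        simp [Fin.sum_univ_four, dotProduct_add, regs_dotProduct_blockForm,
          regs_dotProduct_constForm]
        ring
    _ = if s = blockOf n i then 1 else 0 := by split_ifs <;> lia

lemma advances_placeGates (hL : ∀ i < L, blockOf n i ≤ N) :
    placeGates.Advances n N P tok L 1 := by
  refine advances_zeroTestGates (k := .place) fun i hi s => if_congr ?_ rfl rfl
  have hi' := blockOf_mul_add_placeOf (n := n) i
  rw [dotProduct_sub, dotProduct_add, regs_dotProduct_position, regs_dotProduct_constForm,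
    regs_dotProduct_block (by decide) (hL i hi)]
  lia

lemma score_fetchGates {k : Slot} {t u : ℕ → ℕ → ℤ} {l i j : ℕ} (hl : 1 < l)
    (hi : blockOf n i ≤ N) (hj : blockOf n j ≤ N) :
    (fetchGates k t u).score (regs n N P tok l i) (regs n N P tok l j) =
      (if blockOf n j = blockOf n i - 1 then 1 else 0) +
        (t (blockOf n i) (placeOf n j) + u (placeOf n i) (placeOf n j)) := by
  have hquery : (fun o => regs n N P tok l i ⬝ᵥ (fetchGates k t u).query o) =
      slotForm .block (fun g' => if g' = blockOf n i - 1 then 1 else 0) +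
        slotForm .place fun r => t (blockOf n i) r + u (placeOf n i) r := by
    ext (c | ⟨k', s⟩)
    · simp [fetchGates, slotForm]
    · cases k' <;> simp [fetchGates, slotForm, dotProduct_add, regs_dotProduct_place hl,
        regs_dotProduct_block (Nat.zero_lt_of_lt hl) hi]
  rw [Gates.score, hquery, dotProduct_comm, dotProduct_add, regs_dotProduct_place hl,
    regs_dotProduct_block (Nat.zero_lt_of_lt hl) hj]

lemma dotProduct_fetchGates_value {k : Slot} {t u : ℕ → ℕ → ℤ} {l j : ℕ} (hl : l ≤ 12) :
    (fun o => regs n N P tok l j ⬝ᵥ (fetchGates k t u).value o) =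
      Sum.elim (fun _ => 0) fun o => if o.1 = k then intBit (tokenWord (tok j)) o.2 else 0 := by
  ext (c | ⟨k', s⟩)
  · simp [fetchGates]
  · by_cases hs : (s : ℕ) < w
    · have hinput := dotProduct_inputForm (regs n N P tok l j) ⟨s, by lia⟩
      rcases eq_or_ne k' k with rfl | hne
      · simpa [fetchGates, regs, hs, hl] using hinput
      · simp [fetchGates, hne]
    · simp [fetchGates, hs, intBit_eq_zero (not_lt.1 hs)]

lemma advances_fetchGates {k : Slot} {t u : ℕ → ℕ → ℤ} (hk : 1 < k.layer)
    (hL : ∀ i < L, blockOf n i ≤ N) {r : ℕ → ℕ} (hr : ∀ i, 2 ≤ r i ∧ r i < n + 2)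
    (hr₀ : ∀ i, blockOf n i = 0 → r i = 2)
    (hmax : ∀ i, ∀ q ≠ r i, t (blockOf n i) q + u (placeOf n i) q <
      t (blockOf n i) (r i) + u (placeOf n i) (r i))
    (hvalue : ∀ i s, slotValue n P tok i k s =
      intBit (tokenWord (tok (previousIndex n i (r i)))) s) :
    (fetchGates k t u).Advances n N P tok L k.layer := by
  have hle (i : ℕ) : previousIndex n i (r i) ≤ i := previousIndex_le (hr i).2 (hr₀ i)
  have hblock (i : ℕ) := blockOf_previousIndex (i := i) (hr i).1 (hr i).2
  have hplace (i : ℕ) := placeOf_previousIndex (i := i) (hr i).1 (hr i).2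
  refine .fetch rfl (fun i => ⟨previousIndex n i (r i), (hle i).trans_lt i.is_lt⟩)
    (fun i => hle i) ?_ ?_
  · intro i j _ hne
    rw [score_fetchGates hk (hL i i.is_lt) (hL j j.is_lt),
      score_fetchGates hk (hL i i.is_lt) (hL _ ((hle i).trans_lt i.is_lt)), hblock, hplace,
      if_pos rfl]
    rcases eq_or_ne (placeOf n j) (r i) with hj | hj
    · have hj' : blockOf n j ≠ blockOf n i - 1 := fun h =>
        hne (Fin.ext (eq_of_blockOf_eq_of_placeOf_eq (h.trans (hblock i).symm)
          (hj.trans (hplace i).symm)))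
      rw [if_neg hj', hj]
      lia
    · exact add_lt_add_of_le_of_lt (by split_ifs <;> simp) (hmax i _ hj)
  · intro i
    rw [regs_layer_add_one, dotProduct_fetchGates_value k.layer_lt.le]
    simp only [hvalue]

lemma advances_wordGates [NeZero n] {k : Slot} {s : ℕ} (hk : 1 < k.layer)
    (hL : ∀ i < L, blockOf n i ≤ N)
    (hvalue : ∀ i s', slotValue n P tok i k s' = intBit (tokenWord (tok (wordSource n s i))) s') :
    (wordGates k s).Advances n N P tok L k.layer :=
  advances_fetchGates hk hL (fun i => wordPlace_mem s (blockOf n i))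
    (fun i hi => by simp [wordPlace, hi]) (fun i q hq => by simp [hq]) hvalue

lemma advances_copyGates [NeZero n] (hL : ∀ i < L, blockOf n i ≤ N) :
    copyGates.Advances n N P tok L 5 := by
  refine advances_fetchGates (k := .copiedWord) (by decide) hL
    (r := fun i => if blockOf n i = 0 then 2 else copyPlace n (placeOf n i))
    (fun i => ?_) (fun i hi => if_pos hi) (fun i q hq => ?_) fun _ _ => rfl
  · have := NeZero.pos n
    have := copyPlace_mem (placeOf_lt (n := n) i)
    split_ifs <;> lia
  · by_cases hi : blockOf n i = 0
    · simp only [hi, if_true] at hq ⊢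
      simp only [hq, and_false, and_self, if_true, if_false]
      split_ifs <;> simp
    · simp only [hi, if_false] at hq ⊢
      simp [hq]

lemma regs_dotProduct_mixForm {l i : ℕ} (hl : 3 < l) (s : ℕ) :
    regs n N P tok l i ⬝ᵥ mixForm P s =
      intBit (P.mix (tokenWord (tok (wordSource n 0 i)))
        (tokenWord (tok (wordSource n 1 i)))) s := by
  rw [mixForm, intBit_mix]
  split_ifs
  · exact regs_dotProduct_read_intBit (by simp only [Slot.layer]; lia) (fun _ => rfl) s
  · exact regs_dotProduct_read_intBit (by simp only [Slot.layer]; lia) (fun _ => rfl) s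

lemma advances_twistGates : (twistGates P).Advances n N P tok L 6 := by
  refine advances_parityGates_xor (k := .newWord) (fun i s => ?_) fun _ _ => rfl
  rw [dotProduct_add, dotProduct_add]
  congr 1
  · rw [regs_dotProduct_read_intBit (k := .middleWord) (by decide) (fun _ => rfl),
      regs_dotProduct_mixForm (by decide), intBit_ushiftRight, add_comm s]
  · by_cases ha : P.a.getLsbD s
    · rw [if_pos ha, regs_dotProduct_mixForm (by decide)]
      simp only [intBit]
      split_ifs <;> simp_all
    · rw [if_neg ha, dotProduct_zero]
      simp only [intBit]
      split_ifs <;> simp_all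

lemma advances_shiftRightGates {k k' : Slot} {u : ℕ} {v : ℕ → BitVec w} (hk : k.layer < k'.layer)
    (hv : ∀ i s, slotValue n P tok i k s = intBit (v i) s)
    (hv' : ∀ i s, slotValue n P tok i k' s = intBit (v i ^^^ (v i >>> u)) s) :
    (shiftRightGates k k' u).Advances n N P tok L k'.layer := by
  refine advances_parityGates_xor (v₁ := v) (v₂ := fun i => v i >>> u) (v₃ := fun _ => 0#w)
    (fun i s => ?_) fun i s => by simp [hv']
  rw [dotProduct_add, regs_dotProduct_read_intBit hk (hv i), regs_dotProduct_read_intBit hk (hv i),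
    intBit_ushiftRight, intBit_zero, add_zero]

lemma advances_shiftLeftGates {k k' : Slot} {u : ℕ} {b : BitVec w} {v : ℕ → BitVec w}
    (hk : k.layer < k'.layer) (hv : ∀ i s, slotValue n P tok i k s = intBit (v i) s)
    (hv' : ∀ i s, slotValue n P tok i k' s = intBit (v i ^^^ ((v i <<< u) &&& b)) s) :
    (shiftLeftGates k k' u b).Advances n N P tok L k'.layer := by
  refine advances_parityGates_xor (v₁ := v) (v₂ := fun i => (v i <<< u) &&& b) (v₃ := fun _ => 0#w)
    (fun i s => ?_) fun i s => by simp [hv']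
  rw [dotProduct_add, regs_dotProduct_read_intBit hk (hv i), intBit_shiftLeft_and,
    intBit_zero, add_zero]
  split_ifs
  · rw [regs_dotProduct_read_intBit hk (hv i)]
  · rw [dotProduct_zero]

lemma advances_isNewGates (hL : ∀ i < L, blockOf n i ≤ N) :
    isNewGates.Advances n N P tok L 11 := by
  refine advances_zeroTestGates (k := .isNew) fun i hi _ => if_congr ?_ rfl rfl
  rw [dotProduct_sub, regs_dotProduct_place (by decide),
    regs_dotProduct_block (by decide) (hL i hi)]
  lia

lemma rect_outputGates {i : ℕ} (c : Fin (w + 2)) (hc : (c : ℕ) < w) :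
    intBit (tokenWord (tok i)) c + outputGates.rect (regs n N P tok 12 i) (.inl c) =
      intBit (predictedWord n P tok i) c := by
  have hselect {p q r : Prop} [Decidable p] [Decidable q] [Decidable r] (hpq : p → ¬ q)
      (v₁ v₂ v₃ v₄ : BitVec w) (s : ℕ) :
      intBit v₄ s + (max 0 (intBit v₁ s + (if p then 1 else 0) - 1) +
        max 0 (intBit v₂ s + (if q then 1 else 0) - 1) +
        max 0 (intBit v₃ s - (if p then 1 else 0) - (if q then 1 else 0) - if r then 1 else 0) -
        max 0 (intBit v₄ s)) =
      intBit (if p then v₁ else if q then v₂ else if r then 0#w else v₃) s := by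
    have := intBit_nonneg v₁ s
    have := intBit_nonneg v₂ s
    have := intBit_nonneg v₃ s
    have := intBit_nonneg v₄ s
    have := intBit_le_one v₁ s
    have := intBit_le_one v₂ s
    have := intBit_le_one v₃ s
    have := intBit_zero (w := w) s
    split_ifs <;> lia
  have hinput := dotProduct_inputForm (regs n N P tok 12 i) c
  have hbit {k : Slot} {v : BitVec w} (hv : ∀ s, slotValue n P tok i k s = intBit v s) :=
    regs_dotProduct_read_intBit (N := N) (l := 12) k.layer_lt hv c
  have hflag (k : Slot) {s : ℕ} (hs : s < slotLength n N w) :=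
    regs_dotProduct_read (P := P) (tok := tok) (i := i) k.layer_lt hs
  have hexclusive (h : placeOf n i = 0) : placeOf n i ≠ newPlace n (blockOf n i) := by
    rw [h, newPlace]
    lia
  rw [predictedWord, ← hselect hexclusive _ _ _ (tokenWord (tok i)) c]
  congr 1
  simp only [Gates.rect, outputGates, hc, if_true, Fin.sum_univ_four, outputForms,
    Matrix.cons_val, dotProduct_add, dotProduct_sub, regs_dotProduct_constForm, hinput,
    hbit (k := .temper) fun _ => rfl, hbit (k := .newWord) fun _ => rfl,
    hbit (k := .copiedWord) fun _ => rfl,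
    hflag .place (s := 0) (by lia), hflag .isNew (s := 0) (by lia),
    hflag .place (s := n + 1) (by lia), slotValue, regs, le_refl, eq_comm (a := 0),
    eq_comm (a := n + 1)]
  ring

lemma advances_outputGates : outputGates.Advances n N P tok L 12 := by
  refine .rectify rfl fun i => ?_
  ext (c | ⟨k, s⟩)
  · by_cases hc : (c : ℕ) < w
    · simpa [regs, hc] using (rect_outputGates (i := i) c hc).symm
    · simp [regs, hc, Gates.rect, outputGates]
  · have hk := k.layer_lt
    simp [regs, hk, hk.trans (Nat.lt_succ_self 12), Gates.rect, outputGates]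

lemma advances_idleGates {l : ℕ} (hl : 13 ≤ l) :
    idleGates.Advances n N P tok L l := by
  refine .rectify rfl fun i => ?_
  ext (c | ⟨k, s⟩)
  · simp [regs, Gates.rect, idleGates, show ¬ l ≤ 12 by lia, show ¬ l + 1 ≤ 12 by lia]
  · have hk : k.layer < l := k.layer_lt.trans (by lia)
    simp [regs, Gates.rect, idleGates, hk, hk.trans l.lt_succ_self]

lemma advances_mtGates [NeZero n] (hL : ∀ i < L, blockOf n i ≤ N) :
    ∀ l, (mtGates n N P l).Advances n N P tok L l
  | 0 => advances_blockGates
  | 1 => advances_placeGates hL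
  | 2 => advances_wordGates (k := .currentWord) (by decide) hL fun _ _ => rfl
  | 3 => advances_wordGates (k := .followingWord) (by decide) hL fun _ _ => rfl
  | 4 => advances_wordGates (k := .middleWord) (by decide) hL fun _ _ => rfl
  | 5 => advances_copyGates hL
  | 6 => advances_twistGates
  | 7 => advances_shiftRightGates (k' := .temper₁) (by decide) (fun _ _ => rfl) fun _ _ => rfl
  | 8 => advances_shiftLeftGates (k' := .temper₂) (by decide) (fun _ _ => rfl) fun _ _ => rfl
  | 9 => advances_shiftLeftGates (k' := .temper₃) (by decide) (fun _ _ => rfl) fun _ _ => rfl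
  | 10 => advances_shiftRightGates (k' := .temper) (by decide) (fun _ _ => rfl) fun _ _ => rfl
  | 11 => advances_isNewGates hL
  | 12 => advances_outputGates
  | _ + 13 => advances_idleGates (by lia)

end Advances

section Bounds

variable {n N w R : ℕ}

/-- A bound for the integer weights of the layers. -/
abbrev weightBound (n N w : ℕ) : ℕ := slotLength n N w * (n + 3) + 3

lemma bounded_rectifyGates {k : Slot} {F : ℕ → Fin 4 → Reg n N w → ℤ} {G : Fin 4 → ℤ}
    (hF : ∀ s < slotLength n N w, ∀ j a, |F s j a| ≤ R) (hG : ∀ j, |G j| ≤ R) :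
    (rectifyGates k F G).Bounded R where
  query _ _ := by simp [rectifyGates]
  value _ _ := by simp [rectifyGates]
  hidden
    | .inl _, _, _ => by simp [rectifyGates]
    | .inr (k', s), j, a => by
      simp only [rectifyGates]
      split_ifs
      · exact hF s s.is_lt j a
      · simp
  coeff
    | .inl _, _ => by simp [rectifyGates]
    | .inr (k', s), j => by
      simp only [rectifyGates]
      split_ifs
      · exact hG j
      · simp

lemma bounded_parityGates {k : Slot} {f : ℕ → Reg n N w → ℤ} (hf : ∀ s a, |f s a| ≤ 3)
    (hR : 5 ≤ R) : (parityGates k f).Bounded R := by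
  refine bounded_rectifyGates (fun s _ j a => ?_) fun j => ?_
  · have hs := abs_le.1 (hf s a)
    have h₁ := abs_le.1 (abs_constForm_le 1 a)
    have h₂ := abs_le.1 (abs_constForm_le 2 a)
    simp only [abs_one, Nat.abs_ofNat] at h₁ h₂
    rw [abs_le]
    fin_cases j <;> simp <;> lia
  · fin_cases j <;> simp <;> lia

lemma bounded_zeroTestGates {k : Slot} {f : ℕ → Reg n N w → ℤ} {b : ℕ}
    (hf : ∀ s < slotLength n N w, ∀ a, |f s a| ≤ b) (hb : 0 < b) (hR : b + 1 ≤ R) :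
    (zeroTestGates k f).Bounded R := by
  refine bounded_rectifyGates (fun s hs j a => ?_) fun j => ?_
  · have hs := abs_le.1 (hf s hs a)
    have h₁ := abs_le.1 (abs_constForm_le 1 a)
    simp only [abs_one] at h₁
    rw [abs_le]
    fin_cases j <;> simp <;> lia
  · fin_cases j <;> simp <;> lia

lemma bounded_fetchGates {k : Slot} {t u : ℕ → ℕ → ℤ} (ht : ∀ g r, |t g r| ≤ 2)
    (hu : ∀ q r, |u q r| ≤ 2) (hR : 4 ≤ R) :
    (fetchGates k t u : Gates (Reg n N w)).Bounded R where
  query b a := by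
    unfold fetchGates
    dsimp only
    split
    · exact (abs_slotForm_le zero_le_one (fun g _ => by split_ifs <;> simp) a).trans (by lia)
    · refine (abs_add_le _ _).trans ((add_le_add
        (abs_slotForm_le zero_le_two (fun g _ => ht g _) a)
        (abs_slotForm_le zero_le_two (fun q _ => hu q _) a)).trans (by lia))
    · simp
  value o a := by
    unfold fetchGates
    dsimp only
    split
    · simp
    · split_ifs
      · exact (abs_inputForm_le _ a).trans (by lia)
      · simp
  hidden _ _ _ := by simp [fetchGates]
  coeff _ _ := by simp [fetchGates]

lemma abs_blockForm_le {s : ℕ} (hs : s ≤ slotLength n N w) (a : Reg n N w) :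
    |blockForm s a| ≤ (slotLength n N w * (n + 2) : ℕ) + 1 := by
  have hmul : s * (n + 2) ≤ slotLength n N w * (n + 2) := Nat.mul_le_mul_right _ hs
  have hpos : 0 < slotLength n N w * (n + 2) := by positivity
  have hconst : |(1 - s * (n + 2) : ℤ)| ≤ (slotLength n N w * (n + 2) : ℕ) := by
    rw [abs_le]
    zify at hmul hpos ⊢
    lia
  exact (abs_add_le _ _).trans ((add_le_add (abs_inputForm_le _ a)
    ((abs_constForm_le _ a).trans hconst)).trans_eq (add_comm _ _))

lemma bounded_blockGates (hR : weightBound n N w ≤ R) :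
    (blockGates : Gates (Reg n N w)).Bounded R := by
  have : slotLength n N w * (n + 2) ≤ slotLength n N w * (n + 3) :=
    Nat.mul_le_mul_left _ (by lia)
  refine bounded_rectifyGates (fun s hs j a => ?_) fun j => ?_
  · have h₁ := abs_le.1 (abs_constForm_le 1 a)
    have h₂ := abs_le.1 (abs_blockForm_le hs.le a)
    have h₃ := abs_le.1 (abs_blockForm_le (Nat.succ_le_of_lt hs) a)
    simp only [abs_one, Nat.succ_eq_add_one] at h₁ h₃
    rw [abs_le]
    fin_cases j <;> simp <;> lia
  · fin_cases j <;> simp <;> lia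

lemma bounded_placeGates (hR : weightBound n N w ≤ R) :
    (placeGates : Gates (Reg n N w)).Bounded R := by
  refine bounded_zeroTestGates (b := slotLength n N w * (n + 2) + slotLength n N w + 1)
    (fun s hs a => ?_) (by lia) ?_
  · have hconst : |(1 - s : ℤ)| ≤ slotLength n N w := abs_le.2 ⟨by lia, by lia⟩
    have hblock := abs_slotForm_le (k := .block) (f := fun g => ((g * (n + 2) : ℕ) : ℤ))
      (b := (slotLength n N w * (n + 2) : ℕ)) (by positivity) (fun g hg => by
        rw [Nat.abs_cast]
        exact_mod_cast Nat.mul_le_mul_right _ hg.le) a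
    refine (abs_sub _ _).trans ((add_le_add ((abs_add_le _ _).trans (add_le_add
      (abs_inputForm_le _ a) ((abs_constForm_le _ a).trans hconst))) hblock).trans ?_)
    push_cast
    lia
  · exact (by ring_nf; lia : _ ≤ weightBound n N w).trans hR

lemma bounded_wordGates {k : Slot} {s : ℕ} (hR : 4 ≤ R) :
    (wordGates k s : Gates (Reg n N w)).Bounded R :=
  bounded_fetchGates (fun _ _ => by split_ifs <;> simp) (fun _ _ => by simp) hR

lemma bounded_copyGates (hR : 4 ≤ R) : (copyGates : Gates (Reg n N w)).Bounded R :=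
  bounded_fetchGates (fun _ _ => by split_ifs <;> simp) (fun _ _ => by split_ifs <;> simp) hR

lemma abs_mixForm_le (P : MTParams w) (s : ℕ) (a : Reg n N w) : |mixForm P s a| ≤ 1 := by
  unfold mixForm
  split_ifs
  · exact abs_read_le _ s a
  · exact abs_read_le _ s a

lemma bounded_twistGates {P : MTParams w} (hR : 5 ≤ R) :
    (twistGates P : Gates (Reg n N w)).Bounded R := by
  refine bounded_parityGates (fun s a => ?_) hR
  refine (abs_add_three _ _ _).trans ((add_le_add_three (abs_read_le _ s a)
    (abs_mixForm_le P (s + 1) a) ?_).trans_eq (by norm_num : (1 + 1 + 1 : ℤ) = 3))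
  split_ifs
  · exact abs_mixForm_le P 0 a
  · simp

lemma bounded_shiftRightGates {k k' : Slot} {u : ℕ} (hR : 5 ≤ R) :
    (shiftRightGates k k' u : Gates (Reg n N w)).Bounded R :=
  bounded_parityGates (fun s a => (abs_add_le _ _).trans
    ((add_le_add (abs_read_le k s a) (abs_read_le k (u + s) a)).trans (by norm_num))) hR

lemma bounded_shiftLeftGates {k k' : Slot} {u : ℕ} {b : BitVec w} (hR : 5 ≤ R) :
    (shiftLeftGates k k' u b : Gates (Reg n N w)).Bounded R := by
  refine bounded_parityGates (fun s a => ?_) hR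
  refine (abs_add_le _ _).trans ((add_le_add (abs_read_le k s a)
    (?_ : _ ≤ (1 : ℤ))).trans (by norm_num))
  split_ifs
  · exact abs_read_le k _ a
  · simp

lemma bounded_isNewGates [NeZero n] (hR : weightBound n N w ≤ R) :
    (isNewGates : Gates (Reg n N w)).Bounded R := by
  refine bounded_zeroTestGates (b := slotLength n N w + slotLength n N w)
    (fun s _ a => (abs_sub _ _).trans ((add_le_add
      (abs_slotForm_le (Nat.cast_nonneg _) (fun r hr => ?_) a)
      (abs_slotForm_le (Nat.cast_nonneg _) (fun g _ => ?_) a)).trans_eq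
        (Nat.cast_add _ _).symm)) (by lia) ?_
  · rw [Nat.abs_cast]
    exact_mod_cast hr.le
  · have hmod := Nat.mod_lt (g - 1) (NeZero.pos n)
    rw [Nat.abs_cast, newPlace]
    lia
  · have : slotLength n N w * 2 ≤ slotLength n N w * (n + 3) :=
      Nat.mul_le_mul_left _ (by lia)
    lia

lemma bounded_outputGates (hR : 4 ≤ R) : (outputGates : Gates (Reg n N w)).Bounded R where
  query _ _ := by simp [outputGates]
  value _ _ := by simp [outputGates]
  hidden
    | .inl c, j, a => by
      have h₁ := abs_le.1 (abs_read_le .temper c a)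
      have h₂ := abs_le.1 (abs_read_le .place 0 a)
      have h₃ := abs_le.1 (abs_read_le .newWord c a)
      have h₄ := abs_le.1 (abs_read_le .isNew 0 a)
      have h₅ := abs_le.1 (abs_read_le .copiedWord c a)
      have h₆ := abs_le.1 (abs_read_le .place (n + 1) a)
      have h₇ := abs_le.1 (abs_constForm_le 1 a)
      have h₈ := abs_le.1 (abs_inputForm_le c a)
      rw [abs_one] at h₇
      simp only [outputGates]
      split_ifs
      · rw [abs_le]
        fin_cases j <;> simp [outputForms] <;> lia
      · simp
    | .inr _, _, _ => by simp [outputGates]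
  coeff
    | .inl c, j => by
      simp only [outputGates]
      split_ifs
      · fin_cases j <;> simp <;> lia
      · simp
    | .inr _, _ => by simp [outputGates]

lemma bounded_idleGates : (idleGates : Gates (Reg n N w)).Bounded R :=
  ⟨by simp [idleGates], by simp [idleGates], by simp [idleGates], by simp [idleGates]⟩

lemma bounded_mtGates [NeZero n] {P : MTParams w} (hR : weightBound n N w ≤ R) (l : ℕ) :
    (mtGates n N P l).Bounded R := by
  have : 1 * 3 ≤ slotLength n N w * (n + 3) := Nat.mul_le_mul (by lia) (by lia)
  have hR₅ : 5 ≤ R := by lia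
  have hR₄ : 4 ≤ R := by lia
  match l with
  | 0 => exact bounded_blockGates hR
  | 1 => exact bounded_placeGates hR
  | 2 | 3 | 4 => exact bounded_wordGates hR₄
  | 5 => exact bounded_copyGates hR₄
  | 6 => exact bounded_twistGates hR₅
  | 7 | 10 => exact bounded_shiftRightGates hR₅
  | 8 | 9 => exact bounded_shiftLeftGates hR₅
  | 11 => exact bounded_isNewGates hR
  | 12 => exact bounded_outputGates hR₄
  | _ + 13 => exact bounded_idleGates

end Bounds

/-! ## The chain of thought -/

section Lists

variable {α : Type*} {l₁ l₂ : List α} {f : ℕ → α} {m k : ℕ}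

lemma append_take_eq_map_range (h : l₁ ++ l₂ = (List.range m).map f) (hk : k ≤ l₂.length) :
    l₁ ++ l₂.take k = (List.range (l₁.length + k)).map f := by
  have hm : l₁.length + l₂.length = m := by simpa using congrArg List.length h
  rw [← List.take_length_add_append, h, ← List.map_take, List.take_range, min_eq_left (by lia)]

lemma getElem_eq_of_append_eq_map_range (h : l₁ ++ l₂ = (List.range m).map f)
    (hk : k < l₂.length) : l₂[k] = f (l₁.length + k) := by
  have hget := List.getElem_append_right' l₁ hk
  simp only [h, List.getElem_map, List.getElem_range] at hget
  rw [hget, add_comm]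

end Lists

/-- The token predicted at index `i` for index `i + 1`. -/
def predictedToken (n : ℕ) {w : ℕ} (P : MTParams w) (tok : ℕ → Token w) (i : ℕ) : Token w :=
  if placeOf n i = n + 1 then none else some (predictedWord n P tok i)

section Sequence

variable {n w : ℕ} [NeZero n] (P : MTParams w) (x : Fin n → BitVec w)

/-- The token at index `i` of the prompt followed by the chain of thought. -/
def cotToken (i : ℕ) : Token w :=
  if placeOf n i = 0 then none
  else if placeOf n i = 1 then some (P.output x (blockOf n i - 1))
  else some (P.state x (blockOf n i) (Fin.ofNat n (placeOf n i - 2)))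

lemma tokenWord_predictedToken {tok : ℕ → Token w} (i : ℕ) :
    tokenWord (predictedToken n P tok i) = predictedWord n P tok i := by
  have hmod := Nat.mod_lt (blockOf n i - 1) (NeZero.pos n)
  unfold predictedToken
  split_ifs with h
  · rw [predictedWord, newPlace, if_neg (by lia), if_neg (by lia), if_pos h]
    rfl
  · rfl

variable {P x}

lemma cotToken_eq_state {i g : ℕ} {j : Fin n} (h : g * (n + 2) + (j + 2) = i + 2) :
    cotToken P x i = some (P.state x g j) := by
  obtain ⟨hblock, hplace⟩ := blockOf_eq_and_placeOf_eq (by lia) h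
  simp [cotToken, hblock, hplace]

lemma cotToken_eq_output {i g : ℕ} (h : (g + 1) * (n + 2) + 1 = i + 2) :
    cotToken P x i = some (P.output x g) := by
  obtain ⟨hblock, hplace⟩ := blockOf_eq_and_placeOf_eq (by lia) h
  simp [cotToken, hblock, hplace]

lemma cotToken_eq_none {i g : ℕ} (h : g * (n + 2) = i + 2) : cotToken P x i = none := by
  obtain ⟨-, hplace⟩ := blockOf_eq_and_placeOf_eq (n := n) (r := 0) (by lia) (by rwa [add_zero])
  simp [cotToken, hplace]

variable (P x)

lemma map_some_state_append_none (g : ℕ) :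
    (List.ofFn (P.state x g)).map some ++ [none] =
      (List.range (n + 1)).map fun c => cotToken P x (g * (n + 2) + c) := by
  rw [List.range_succ, List.map_append]
  congr 1
  · refine List.ext_getElem (by simp) fun j hj _ => ?_
    have hj' : j < n := by simpa using hj
    simp only [List.getElem_map, List.getElem_ofFn, List.getElem_range]
    exact (cotToken_eq_state (j := ⟨j, hj'⟩) (add_assoc _ _ _).symm).symm
  · simp only [List.map_cons, List.map_nil]
    rw [cotToken_eq_none (g := g + 1) (by ring)]

lemma prompt_append_cot (N : ℕ) :
    prompt x ++ cot P x N = (List.range (n + 1 + N * (n + 2))).map (cotToken P x) := by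
  induction N with
  | zero => simpa [cot, prompt, MTParams.state] using map_some_state_append_none P x 0
  | succ N ih =>
    have hblock : cotBlock P x N = (List.range (n + 2)).map fun c =>
        cotToken P x (n + 1 + N * (n + 2) + c) := by
      rw [List.range_succ_eq_map, cotBlock, map_some_state_append_none, List.map_cons,
        List.map_map, cotToken_eq_output (g := N) (by ring)]
      congr 2
      funext c
      exact congrArg (cotToken P x) (by rw [Nat.succ_eq_add_one]; ring)
    have hcot : cot P x (N + 1) = cot P x N ++ cotBlock P x N := by
      simp [cot, List.range_succ]
    rw [hcot, ← List.append_assoc, ih, hblock, add_one_mul, ← add_assoc,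
      List.range_add (n := n + 1 + N * (n + 2)), List.map_append, List.map_map]
    rfl

omit [NeZero n] in
lemma length_prompt : (prompt x).length = n + 1 := by simp [prompt]

lemma length_cot (N : ℕ) : (cot P x N).length = N * (n + 2) := by
  simpa [length_prompt, add_assoc] using congrArg List.length (prompt_append_cot P x N)

variable {P x} {i g : ℕ}

lemma tokenWord_cotToken_wordSource (s : ℕ) (hi : blockOf n i = g + 1) :
    tokenWord (cotToken P x (wordSource n s i)) = P.state x g (Fin.ofNat n (g + s)) := by
  have hsource : cotToken P x (wordSource n s i) = some (P.state x g (Fin.ofNat n (g + s))) := by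
    refine cotToken_eq_state ?_
    simp only [wordSource, previousIndex, wordPlace, hi, Nat.add_sub_cancel, Fin.val_ofNat]
    lia
  rw [hsource]
  rfl

lemma newWord_cotToken (hi : blockOf n i = g + 1) :
    newWord n P (cotToken P x) i = P.state x (g + 1) (Fin.ofNat n g) := by
  simp only [newWord, tokenWord_cotToken_wordSource _ hi, MTParams.state, Function.update_self]
  rfl

lemma predictedWord_cotToken {j : Fin n} (hi : blockOf n i = g + 1) (hj : placeOf n i = j + 1) :
    predictedWord n P (cotToken P x) i = P.state x (g + 1) j := by
  rw [predictedWord, if_neg (by lia), newPlace, hi, Nat.add_sub_cancel]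
  split_ifs with hnew hlast
  · rw [newWord_cotToken hi]
    congr 1
    exact Fin.ext (by simp only [Fin.val_ofNat]; lia)
  · have := j.is_lt
    lia
  · have hsource : cotToken P x (copySource n i) = some (P.state x g j) := by
      refine cotToken_eq_state ?_
      have hplace : copyPlace n (placeOf n i) = j + 2 := by
        rw [copyPlace, if_neg (by lia), if_neg hlast, hj]
      rw [copySource, hi, if_neg g.succ_ne_zero, hplace, previousIndex, hi, Nat.add_sub_cancel]
      lia
    have hne : j ≠ Fin.ofNat n g := by
      rintro rfl
      exact hnew (by rw [hj, Fin.val_ofNat, add_comm])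
    rw [hsource, MTParams.state, Function.update_of_ne hne]
    rfl

lemma cotToken_add_one (hi : blockOf n i ≠ 0) :
    cotToken P x (i + 1) = predictedToken n P (cotToken P x) i := by
  obtain ⟨g, hg⟩ := Nat.exists_eq_add_one_of_ne_zero hi
  have hindex := blockOf_mul_add_placeOf (n := n) i
  rw [hg] at hindex
  rw [predictedToken]
  split_ifs with hlast
  · exact cotToken_eq_none (g := g + 2) (by rw [add_mul] at hindex ⊢; lia)
  · rcases hplace : placeOf n i with _ | j
    · rw [cotToken_eq_output (g := g) (by lia), predictedWord, if_pos hplace, newWord_cotToken hg]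
      rfl
    · have hj : j < n := by
        have := placeOf_lt (n := n) i
        lia
      rw [predictedWord_cotToken (j := ⟨j, hj⟩) hg hplace]
      exact cotToken_eq_state (by simp only; lia)

lemma prompt_append_take_cot {N k : ℕ} (hk : k < (cot P x N).length) :
    prompt x ++ (cot P x N).take k = (List.range (n + k + 1)).map (cotToken P x) := by
  rw [append_take_eq_map_range (prompt_append_cot P x N) hk.le, length_prompt, add_right_comm]

lemma getElem_cot {N k : ℕ} (hk : k < (cot P x N).length) :
    (cot P x N)[k] = predictedToken n P (cotToken P x) (n + k) := by
  rw [getElem_eq_of_append_eq_map_range (prompt_append_cot P x N) hk, length_prompt,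
    add_right_comm, cotToken_add_one]
  exact (Nat.div_pos (by lia) (by lia)).ne'

end Sequence

/-! ## Greedy decoding -/

namespace Precise

variable {V : Type} [Fintype V] {d p : ℕ} {B R η : ℝ} {ρ : ℝ → ℝ}

lemma abs_logit_sub_le (hρ : Precise p B R ρ) (hd : d ≤ R) (hη : 1 / 2 ^ p ≤ η)
    (hη1 : R ^ 3 * η ≤ 1) {x y u : Fin d → ℝ} (hxy : Tracks R η x y) (hu : ∀ c, |u c| ≤ R) :
    |ρ (x ⬝ᵥ u) - y ⬝ᵥ u| ≤ 1 / 4 := by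
  have hR := hρ.nine_le
  have hR0 : 0 ≤ R := by linarith
  have hR1 : 1 ≤ R := by linarith
  have hη0 : 0 ≤ η := le_trans (by positivity) hη
  have hcard : (Fintype.card (Fin d) : ℝ) ≤ R := by simpa using hd
  have hlin : |x ⬝ᵥ u - y ⬝ᵥ u| ≤ R * (η * R) := by
    rw [← sub_dotProduct]
    exact abs_dotProduct_le hη0 hR0 hcard (fun c => (hxy c).1) hu
  have hlarge : |y ⬝ᵥ u| ≤ R * (R * R) :=
    abs_dotProduct_le hR0 hR0 hcard (fun c => (hxy c).2) hu
  have hsmall : 9 * (R * (η * R)) ≤ 1 := by nlinarith [mul_nonneg (sq_nonneg R) hη0]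
  have hηR : 81 * η ≤ R * (η * R) := by nlinarith [mul_le_mul hR hR (by norm_num) hR0]
  have hrange : R * (R * R) + 1 ≤ B := by nlinarith [hρ.pow_four_le, one_le_pow₀ (n := 3) hR1]
  exact (hρ.isRounding.abs_sub_le_add hlin (by linarith)).trans (by linarith)

lemma isNext_of_gap (hρ : Precise p B R ρ) (hd : d ≤ R) (hη : 1 / 2 ^ p ≤ η)
    (hη1 : R ^ 3 * η ≤ 1) {T : Transformer V d} (hT : ∀ v c, |T.unembed v c| ≤ R) {s : List V}
    {y : Fin d → ℝ} (hy : Tracks R η (T.final ρ s) y) {v : V}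
    (hgap : ∀ v' ≠ v, y ⬝ᵥ T.unembed v' + 1 ≤ y ⬝ᵥ T.unembed v) : T.IsNext ρ s v := by
  intro v' hne
  have hv := abs_le.1 (hρ.abs_logit_sub_le hd hη hη1 hy (hT v))
  have hv' := abs_le.1 (hρ.abs_logit_sub_le hd hη hη1 hy (hT v'))
  refine div_lt_div_of_pos_right (Real.exp_lt_exp.2 (by linarith [hv.1, hv'.2, hgap v' hne])) ?_
  exact sum_pos (fun _ _ => Real.exp_pos _) ⟨v, mem_univ v⟩

end Precise

/-! ## The output matrix -/

section Unembedding

variable {n N w : ℕ}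

/-- A bit of a word as a sign. -/
def bitSign (v : BitVec w) (s : ℕ) : ℤ := 2 * intBit v s - 1

/-- The column of the output matrix for a token. For a number it counts the agreements minus the
disagreements with the predicted bits, so that it is at most `w`, and less than `w` for a wrong
number; for the separator it is `w + 1` at the last place of a block and `-1` elsewhere. -/
def unembedForm : Token w → Reg n N w → ℤ
  | some v => (∑ c : Fin w, (2 * bitSign v c) • inputForm c) - constForm (∑ c : Fin w, bitSign v c)
  | none => slotForm .place (fun s => if s = n + 1 then (w + 2 : ℤ) else 0) - constForm 1

lemma bitSign_mul_self (v : BitVec w) (s : ℕ) : bitSign v s * bitSign v s = 1 := by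
  unfold bitSign intBit; split_ifs <;> simp

lemma abs_bitSign (v : BitVec w) (s : ℕ) : |bitSign v s| = 1 := by
  unfold bitSign intBit; split_ifs <;> simp

lemma bitSign_mul_le_one (v v' : BitVec w) (s : ℕ) : bitSign v s * bitSign v' s ≤ 1 :=
  (le_abs_self _).trans_eq (by rw [abs_mul, abs_bitSign, abs_bitSign, one_mul])

lemma sum_bitSign_mul_le (v v' : BitVec w) : ∑ c : Fin w, bitSign v c * bitSign v' c ≤ w :=
  (sum_le_sum fun (c : Fin w) _ => bitSign_mul_le_one v v' c).trans (by simp)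

lemma sum_bitSign_mul_self (v : BitVec w) : ∑ c : Fin w, bitSign v c * bitSign v c = w := by
  simp [bitSign_mul_self]

lemma sum_bitSign_mul_lt {v v' : BitVec w} (hv : v' ≠ v) :
    ∑ c : Fin w, bitSign v c * bitSign v' c < w := by
  obtain ⟨c, hc, hne⟩ : ∃ c, c < w ∧ v.getLsbD c ≠ v'.getLsbD c := by
    by_contra! hcon
    exact hv (BitVec.eq_of_getLsbD_eq fun c hc => (hcon c hc).symm)
  have hstrict : bitSign v c * bitSign v' c < 1 := by
    unfold bitSign intBit
    cases h₁ : v.getLsbD c <;> cases h₂ : v'.getLsbD c <;> simp_all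
  exact (sum_lt_sum (fun (c : Fin w) _ => bitSign_mul_le_one v v' c)
    ⟨⟨c, hc⟩, mem_univ _, hstrict⟩).trans_eq (by simp)

lemma abs_unembedForm_le {R : ℕ} (hR : 3 * w + 3 ≤ R) (v : Token w) (a : Reg n N w) :
    |unembedForm v a| ≤ R := by
  rcases v with _ | v
  · have hplace := abs_slotForm_le (k := .place)
      (f := fun s => if s = n + 1 then (w + 2 : ℤ) else 0) (b := w + 2) (by positivity)
      (fun s _ => abs_le.2 (by split_ifs <;> constructor <;> lia)) a
    refine (abs_sub _ _).trans ((add_le_add hplace (abs_constForm_le 1 a)).trans ?_)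
    rw [abs_one]
    lia
  · have hbits : |(∑ c : Fin w, (2 * bitSign v c) • inputForm c : Reg n N w → ℤ) a| ≤ w * 2 := by
      rw [Finset.sum_apply]
      refine (abs_sum_le_sum_abs _ _).trans ((sum_le_card_nsmul _ _ 2 fun c _ => ?_).trans_eq
        (by simp))
      rw [Pi.smul_apply, smul_eq_mul, abs_mul, abs_mul, abs_bitSign, abs_two, mul_one]
      exact mul_le_of_le_one_right zero_le_two (abs_inputForm_le _ a)
    have hconst : |∑ c : Fin w, bitSign v c| ≤ w :=
      (abs_sum_le_sum_abs _ _).trans_eq (by simp [abs_bitSign])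
    refine (abs_sub _ _).trans ((add_le_add hbits ((abs_constForm_le _ a).trans hconst)).trans ?_)
    lia

variable {P : MTParams w} {tok : ℕ → Token w} {l i : ℕ}

lemma regs_dotProduct_unembedForm_some (hl : 12 < l) (v : BitVec w) :
    regs n N P tok l i ⬝ᵥ unembedForm (some v) =
      ∑ c : Fin w, bitSign (predictedWord n P tok i) c * bitSign v c := by
  have hbit (c : Fin w) :
      regs n N P tok l i ⬝ᵥ inputForm c = intBit (predictedWord n P tok i) c := by
    rw [← Fin.val_castAdd 2 c, dotProduct_inputForm]
    simp [regs, hl.not_ge]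
  rw [unembedForm, dotProduct_sub, dotProduct_sum, regs_dotProduct_constForm, ← sum_sub_distrib]
  refine sum_congr rfl fun c _ => ?_
  rw [dotProduct_smul, hbit, smul_eq_mul, bitSign, bitSign]
  ring

lemma regs_dotProduct_unembedForm_none (hl : 1 < l) :
    regs n N P tok l i ⬝ᵥ unembedForm none =
      (if placeOf n i = n + 1 then (w + 2 : ℤ) else 0) - 1 := by
  rw [unembedForm, dotProduct_sub, regs_dotProduct_constForm, regs_dotProduct_place hl]

lemma regs_dotProduct_unembedForm_lt (hl : 12 < l) {v : Token w}
    (hv : v ≠ predictedToken n P tok i) :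
    regs n N P tok l i ⬝ᵥ unembedForm v <
      regs n N P tok l i ⬝ᵥ unembedForm (predictedToken n P tok i) := by
  have hl₁ : 1 < l := by lia
  unfold predictedToken at hv ⊢
  split_ifs at hv ⊢ with hlast
  · obtain ⟨v, rfl⟩ := Option.ne_none_iff_exists'.1 hv
    rw [regs_dotProduct_unembedForm_some hl, regs_dotProduct_unembedForm_none hl₁, if_pos hlast]
    linarith [sum_bitSign_mul_le (predictedWord n P tok i) v]
  · rw [regs_dotProduct_unembedForm_some hl, sum_bitSign_mul_self]
    rcases v with _ | v
    · rw [regs_dotProduct_unembedForm_none hl₁, if_neg hlast]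
      lia
    · rw [regs_dotProduct_unembedForm_some hl]
      exact sum_bitSign_mul_lt fun h => hv (congrArg some h)

end Unembedding

/-! ## The Transformer -/

section Model

variable {n N w : ℕ} {P : MTParams w}

/-- The Transformer that simulates the Mersenne Twister, with precision `p`. -/
noncomputable def mtTransformer (P : MTParams w) (n N p : ℕ) :
    Transformer (Token w) (hiddenDim n N w) where
  embed v c := bit v c
  pos j c := if (c : ℕ) = w then (j : ℝ) else if (c : ℕ) = w + 1 then 1 else 0
  layers := (List.range 17).map fun l => (mtGates n N P l).toLayer (regEquiv n N w) (2 ^ p)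
  unembed v := hiddenVec (regEquiv n N w) (unembedForm v)

lemma length_layers_mtTransformer (p : ℕ) : (mtTransformer P n N p).layers.length = 17 := by
  simp [mtTransformer]

lemma heads_mtTransformer {p : ℕ} {lay : Layer (hiddenDim n N w)}
    (hlay : lay ∈ (mtTransformer P n N p).layers) : lay.H = 1 := by
  obtain ⟨l, -, rfl⟩ := List.mem_map.1 hlay
  rfl

lemma binaryInput_mtTransformer (p : ℕ) : BinaryInput (mtTransformer P n N p) :=
  ⟨by lia, fun _ _ => rfl, fun _ _ => rfl⟩

lemma bit_eq_intBit (t : Token w) (c : ℕ) : bit t c = intBit (tokenWord t) c := by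
  rcases t with _ | v
  · simp [bit, intBit, tokenWord]
  · change (if v.getLsbD c then (1 : ℝ) else 0) = ((if v.getLsbD c then 1 else 0 : ℤ) : ℝ)
    split_ifs <;> simp

lemma allParams_mtTransformer [NeZero n] {p R : ℕ} {B : ℝ} (hR : weightBound n N w ≤ R)
    (hB : 2 ^ p * (R : ℝ) ≤ B) : (mtTransformer P n N p).AllParams (FixedPoint p B) := by
  have hRB : (R : ℝ) ≤ B :=
    (le_mul_of_one_le_left (Nat.cast_nonneg R) (one_le_pow₀ one_le_two)).trans hB
  refine ⟨fun v c => ?_, fun v c => ?_, fun lay hlay => ?_⟩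
  · refine FixedPoint.of_zero ?_ hRB
    change FixedPoint 0 R (bit v c)
    rw [bit_eq_intBit]
    exact fixedPoint_zero_intCast ((abs_intBit_le_one _ _).trans (by lia))
  · exact (fixedPoint_hiddenVec (abs_unembedForm_le (by lia) v) c).of_zero hRB
  · obtain ⟨l, -, rfl⟩ := List.mem_map.1 hlay
    exact (bounded_mtGates hR l).allParams_toLayer (by lia) hB

lemma hiddenVec_regEquiv (x : Reg n N w → ℤ) {c : Fin (hiddenDim n N w)} (hc : (c : ℕ) < w + 2) :
    hiddenVec (regEquiv n N w) x c = x (.inl ⟨c, hc⟩) := by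
  have hindex : regEquiv n N w (.inl ⟨c, hc⟩, 0) = c := Fin.ext (regEquiv_inl _)
  conv_lhs => rw [← hindex]
  simp [hiddenVec]

variable {tok : ℕ → Token w} {i : ℕ}

lemma hiddenVec_regs_zero_of_le {c : Fin (hiddenDim n N w)} (hc : w + 2 ≤ (c : ℕ)) :
    hiddenVec (regEquiv n N w) (regs n N P tok 0 i) c = 0 := by
  obtain ⟨⟨o, k⟩, rfl⟩ := (regEquiv n N w).surjective c
  rw [hiddenVec, Equiv.symm_apply_apply]
  split_ifs with hk
  · rcases o with c | ⟨k, s⟩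
    · rw [show k = 0 from hk, regEquiv_inl] at hc
      exact absurd c.is_lt hc.not_gt
    · simp [regs]
  · rfl

lemma input_mtTransformer {p : ℕ} {s : List (Token w)} {j : Fin s.length} (hj : s.get j = tok j) :
    (mtTransformer P n N p).input s j = hiddenVec (regEquiv n N w) (regs n N P tok 0 j) := by
  ext c
  simp only [Transformer.input, mtTransformer, Pi.add_apply, hj, bit_eq_intBit]
  rcases lt_or_ge (c : ℕ) (w + 2) with hc | hc
  · rw [hiddenVec_regEquiv _ hc]
    simp only [regs, zero_le, if_true]
    rcases lt_or_ge (c : ℕ) w with hw | hw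
    · simp [hw, hw.ne, show (c : ℕ) ≠ w + 1 by lia]
    · rw [intBit_eq_zero hw, if_neg hw.not_gt]
      obtain hw' | hw' : (c : ℕ) = w ∨ (c : ℕ) = w + 1 := by lia
      all_goals simp [hw']
  · rw [hiddenVec_regs_zero_of_le hc, intBit_eq_zero (by lia), if_neg (by lia), if_neg (by lia)]
    simp

section Decoding

variable [NeZero n] {p R : ℕ} {B ε : ℝ} {ρ : ℝ → ℝ}

lemma tracks_final_mtTransformer (hρ : Precise p B R ρ) (hR : weightBound n N w ≤ R)
    (hd : hiddenDim n N w ≤ R) (hp : (R : ℝ) ^ (11 * 17) * (1 / 2 ^ p) ≤ 1)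
    {s : List (Token w)} (hs : s = (List.range (i + 1)).map tok) (hi : i + 3 ≤ (N + 1) * (n + 2)) :
    Tracks R (R ^ (11 * 17) * (1 / 2 ^ p)) ((mtTransformer P n N p).final ρ s)
      (hiddenVec (regEquiv n N w) (regs n N P tok 17 i)) := by
  have hlen : s.length = i + 1 := by simp [hs]
  have hiR : i + 3 ≤ R := by
    have : (N + 1) * (n + 2) ≤ slotLength n N w * (n + 3) := Nat.mul_le_mul (by lia) (by lia)
    lia
  have hblock (j : ℕ) (hj : j < s.length) : blockOf n j ≤ N := by
    rw [blockOf, ← Nat.lt_add_one_iff, Nat.div_lt_iff_lt_mul (by lia)]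
    lia
  have hget (j : Fin s.length) : s.get j = tok j := by simp [hs]
  have hpos : 0 < s.length := by lia
  obtain rfl : i = s.length - 1 := by lia
  rw [Transformer.final, dif_pos hpos]
  exact Gates.tracks_foldl_toLayer hρ hd (by lia) hp (fun l _ => bounded_mtGates hR l)
    (X := fun l (j : Fin s.length) => regs n N P tok l j)
    (fun l _ => advances_mtGates hblock l)
    (fun l _ j => abs_regs_le (by have := j.is_lt; lia))
    (fun j => input_mtTransformer (hget j)) _

variable (x : Fin n → BitVec w)

lemma tracks_final_prompt_append_take_cot (hρ : Precise p B R ρ) (hR : weightBound n N w ≤ R)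
    (hd : hiddenDim n N w ≤ R) (hp : (R : ℝ) ^ (11 * 17) * (1 / 2 ^ p) ≤ 1) {k : ℕ}
    (hk : k < (cot P x N).length) :
    Tracks R (R ^ (11 * 17) * (1 / 2 ^ p))
      ((mtTransformer P n N p).final ρ (prompt x ++ (cot P x N).take k))
      (hiddenVec (regEquiv n N w) (regs n N P (cotToken P x) 17 (n + k))) := by
  refine tracks_final_mtTransformer hρ hR hd hp (prompt_append_take_cot hk) ?_
  rw [length_cot] at hk
  rw [add_one_mul]
  lia

lemma generates_mtTransformer (hρ : Precise p B R ρ) (hR : weightBound n N w ≤ R)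
    (hd : hiddenDim n N w ≤ R) (hp : (R : ℝ) ^ (11 * 17 + 3) * (1 / 2 ^ p) ≤ 1) :
    (mtTransformer P n N p).Generates ρ (prompt x) (cot P x N) := by
  have hR1 : (1 : ℝ) ≤ R := by linarith [hρ.nine_le]
  have hsplit : (R : ℝ) ^ (11 * 17 + 3) * (1 / 2 ^ p) = R ^ 3 * (R ^ (11 * 17) * (1 / 2 ^ p)) := by
    ring
  have hp' : (R : ℝ) ^ (11 * 17) * (1 / 2 ^ p) ≤ 1 :=
    (le_mul_of_one_le_left (by positivity) (one_le_pow₀ hR1)).trans (hsplit ▸ hp)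
  intro k hk
  rw [getElem_cot hk]
  refine hρ.isNext_of_gap (by exact_mod_cast hd)
    (le_mul_of_one_le_left (by positivity) (one_le_pow₀ hR1)) (hsplit ▸ hp)
    (fun v c => (fixedPoint_hiddenVec (abs_unembedForm_le (by lia) v) c).1)
    (tracks_final_prompt_append_take_cot x hρ hR hd hp' hk) fun v hv => ?_
  have hdot (v : Token w) :
      hiddenVec (regEquiv n N w) (regs n N P (cotToken P x) 17 (n + k)) ⬝ᵥ
        (mtTransformer P n N p).unembed v =
      (regs n N P (cotToken P x) 17 (n + k) ⬝ᵥ unembedForm v : ℤ) :=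
    hiddenVec_dotProduct_intCast _ _ _ fun o => by simp [mtTransformer, hiddenVec]
  rw [hdot, hdot]
  exact_mod_cast Int.add_one_le_iff.2 (regs_dotProduct_unembedForm_lt (by norm_num) hv)

lemma approximatesBits_mtTransformer (hρ : Precise p B R ρ) (hR : weightBound n N w ≤ R)
    (hd : hiddenDim n N w ≤ R) (hp : (R : ℝ) ^ (11 * 17) * (1 / 2 ^ p) ≤ 1)
    (hε : (R : ℝ) ^ (11 * 17) * (1 / 2 ^ p) ≤ ε) :
    ApproximatesBits (mtTransformer P n N p) ρ ε (prompt x) (cot P x N) := by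
  intro k hk c hc
  have hbit : hiddenVec (regEquiv n N w) (regs n N P (cotToken P x) 17 (n + k)) c =
      bit (cot P x N)[k] c := by
    rw [hiddenVec_regEquiv _ (by lia), bit_eq_intBit, getElem_cot hk, tokenWord_predictedToken]
    simp [regs, hc]
  rw [← hbit]
  exact (tracks_final_prompt_append_take_cot x hρ hR hd hp hk c).1.trans hε

end Decoding

end Model

/-! ## Sizes -/

lemma weightBound_le {n N w : ℕ} [NeZero n] : weightBound n N w ≤ 200 * (n + N + w) ^ 2 := by
  have hn := NeZero.pos n
  have hmul : slotLength n N w * (n + 3) ≤ (3 * (n + N + w)) * (4 * (n + N + w)) :=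
    Nat.mul_le_mul (by lia) (by lia)
  nlinarith

lemma hiddenDim_le {n N w : ℕ} [NeZero n] : hiddenDim n N w ≤ 200 * (n + N + w) := by
  have hn := NeZero.pos n
  lia

lemma exists_mul_le_and_two_pow_le {ε : ℝ} (hε : 0 < ε) :
    ∃ E : ℕ, ∀ T : ℕ, 0 < T → ∃ p : ℕ, (T : ℝ) * (1 / 2 ^ p) ≤ ε ∧ 2 ^ p ≤ E * T := by
  obtain ⟨E, hE⟩ := exists_nat_gt (1 / ε)
  have hE0 : 0 < E := by exact_mod_cast (one_div_pos.2 hε).trans hE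
  refine ⟨2 * E, fun T hT => ?_⟩
  have hET : 1 ≤ E * T := Nat.mul_pos hE0 hT
  obtain ⟨q, hle, hlt⟩ := exists_nat_pow_near hET one_lt_two
  refine ⟨q + 1, ?_, by rw [pow_succ]; lia⟩
  have hlt' : (E : ℝ) * T < 2 ^ (q + 1) := by exact_mod_cast hlt
  rw [mul_one_div, div_le_iff₀ (by positivity)]
  calc (T : ℝ) = 1 * T := (one_mul _).symm
    _ ≤ ε * E * T := by
        gcongr
        exact (div_le_iff₀' hε).1 hE.le
    _ = ε * (E * T) := mul_assoc _ _ _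
    _ ≤ ε * 2 ^ (q + 1) := by gcongr

lemma exists_precision {ε : ℝ} (hε : 0 < ε) {c : ℕ} (hc : 0 < c) (a b : ℕ) :
    ∃ C k : ℕ, c ≤ C ∧ ∀ S R : ℕ, 0 < S → R = c * S ^ 2 →
      ∃ p : ℕ, (R : ℝ) ^ a * (1 / 2 ^ p) ≤ ε ∧ 2 ^ p * R ^ b ≤ C * S ^ k := by
  obtain ⟨E, hE⟩ := exists_mul_le_and_two_pow_le hε
  refine ⟨c + E * c ^ (a + b), 2 * (a + b), by lia, fun S R hS hR => ?_⟩
  obtain ⟨p, hp, hpE⟩ := hE (R ^ a) (pow_pos (hR ▸ by positivity) a)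
  refine ⟨p, by exact_mod_cast hp, ?_⟩
  calc 2 ^ p * R ^ b ≤ E * R ^ a * R ^ b := Nat.mul_le_mul_right _ hpE
    _ = E * c ^ (a + b) * S ^ (2 * (a + b)) := by rw [hR]; ring
    _ ≤ (c + E * c ^ (a + b)) * S ^ (2 * (a + b)) := by gcongr; lia

end MTTransformer

open MTTransformer in
theorem mainTheorem2 (ε : ℝ) (hε : 0 < ε) :
    ∃ C k : ℕ, ∀ (n N w : ℕ) [NeZero n] (P : MTParams w),
      ∃ (d : ℕ) (T : Transformer (Token w) d) (p : ℕ) (B : ℝ),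
        d ≤ C * (n + N + w) ∧
        T.layers.length = 17 ∧
        (∀ lay ∈ T.layers, lay.H ≤ 4) ∧
        B ≤ (C : ℝ) * ((n + N + w : ℕ) : ℝ) ^ k ∧
        2 ^ p ≤ C * (n + N + w) ^ k ∧
        T.AllParams (FixedPoint p B) ∧
        BinaryInput T ∧
        ∀ ρ : ℝ → ℝ, IsRounding p B ρ → ∀ x : Fin n → BitVec w,
          T.Generates ρ (prompt x) (cot P x N) ∧
          ApproximatesBits T ρ ε (prompt x) (cot P x N) := by
  obtain ⟨C, k, hC, hprecision⟩ :=
    exists_precision (lt_min hε one_pos) (c := 200) (by norm_num) (11 * 17 + 3) 4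
  refine ⟨C, k, fun n N w _ P => ?_⟩
  have hn : 0 < n := NeZero.pos n
  obtain ⟨R, hR⟩ : ∃ R, R = 200 * (n + N + w) ^ 2 := ⟨_, rfl⟩
  obtain ⟨p, hp, hB⟩ := hprecision (n + N + w) R (by lia) hR
  obtain ⟨hpε, hp1⟩ := le_min_iff.1 hp
  have hsize : weightBound n N w ≤ R := hR ▸ weightBound_le
  have hdim : hiddenDim n N w ≤ R :=
    hR ▸ hiddenDim_le.trans (Nat.mul_le_mul_left _ (Nat.le_self_pow two_ne_zero _))
  have hR1 : (1 : ℝ) ≤ R := by exact_mod_cast (by lia : 1 ≤ R)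
  have hpow : (R : ℝ) ^ (11 * 17) * (1 / 2 ^ p) ≤ R ^ (11 * 17 + 3) * (1 / 2 ^ p) :=
    mul_le_mul_of_nonneg_right (pow_le_pow_right₀ hR1 (by norm_num)) (by positivity)
  refine ⟨hiddenDim n N w, mtTransformer P n N p, p, 2 ^ p * R ^ 4,
    hiddenDim_le.trans (Nat.mul_le_mul_right _ hC), length_layers_mtTransformer p,
    fun _ hlay => (heads_mtTransformer hlay).trans_le (by norm_num), by exact_mod_cast hB,
    (Nat.le_mul_of_pos_right _ (pow_pos (by lia) 4)).trans hB,
    allParams_mtTransformer hsize (by gcongr; exact le_self_pow₀ hR1 (by norm_num)),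
    binaryInput_mtTransformer p, fun ρ hρ x => ?_⟩
  have hprecise : Precise p (2 ^ p * R ^ 4) R ρ := ⟨hρ, by exact_mod_cast (by lia : 9 ≤ R), le_rfl⟩
  exact ⟨generates_mtTransformer x hprecise hsize hdim hp1,
    approximatesBits_mtTransformer x hprecise hsize hdim (hpow.trans hp1) (hpow.trans hpε)⟩
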